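/- Let $-1<q<1$ and let $\nu$ be a finite Borel measure on $\mathbb R$ with compact support; put $r_2=\nu(\mathbb R)$. Let $\mathcal H=L^2(\mathbb R_+,dt)\otimes L^2(\mathbb R,\nu)$ (complex Hilbert space) and let $\mathcal F_q(\mathcal H)$ be the $q$-Fock space, i.e. the completion of $\bigoplus_{n\ge 0}\mathcal H^{\otimes n}$ (with $\mathcal H^{\otimes 0}=\mathbb C\Omega$) with respect to the inner product determined by $$\langle \xi_1\otimes\dots\otimes\xi_n,\eta_1\otimes\dots\otimes\eta_k\rangle_q=\delta_{nk}\sum_{\sigma\in \mathrm{Sym}(n)}q^{i(\sigma)}\prod_{j=1}^n\langle\xi_j,\eta_{\sigma(j)}\rangle ,$$ where $i(\sigma)$ is the number of inversions of $\sigma$. For $\zeta\in\mathcal H$ and a bounded operator $T$ on $\mathcal H$ let $p(\zeta,T)=a(\zeta)+a^*(\zeta)+p(T)$ be the bounded operator on $\mathcal F_q(\mathcal H)$ with $$a^*(\zeta)\,\eta_1\otimes\dots\otimes\eta_n=\zeta\otimes\eta_1\otimes\dots\otimes\eta_n,\qquad a(\zeta)\,\eta_1\otimes\dots\otimes\eta_n=\sum_{k=1}^n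 q^{k-1}\langle\zeta,\eta_k\rangle\,\eta_1\otimes\dots\check\eta_k\dots\otimes\eta_n,$$ $$p(T)\,\eta_1\otimes\dots\otimes\eta_n=\sum_{k=1}^n q^{k-1}(T\eta_k)\otimes\eta_1\otimes\dots\check\eta_k\dots\otimes\eta_n ,$$ where $\check\eta_k$ means that $\eta_k$ is omitted, and $a(\zeta)\Omega=p(T)\Omega=0$, $a^*(\zeta)\Omega=\zeta$. For an interval $I=[a,b)\subset\mathbb R_+$ and $k\ge1$ put $Y_k(I)=p(\chi_I\otimes x^{k-1},\,M_{\chi_I\otimes x^{k}})$, where $M_f$ is multiplication by $f$; let $X(I)=Y_1(I)$ (the $q$-Lévy process with canonical measure $\nu$) and $Y_k(s)=Y_k([0,s))$. Let $\mathcal A_{X,\Delta}$ be the von Neumann algebra generated by all $Y_k(s)$, $k\ge 1$, $s\ge0$, and $\mathcal A_{X,\Delta}(t)$ the one generated by $Y_k(s)$, $k\ge1$, $0\le s<t$. Put $\langle A,B\rangle_\phi=\langle\Omega,A^*B\,\Omega\rangle_q$ and let $L^2(\mathcal A_{X,\Delta},\phi)$ be the Hilbert space completion of $\mathcal A_{X,\Delta}$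 for this inner product (after dividing out vectors of norm zero, if any). A simple adapted process is a finite sum $U(t)=\sum_{i=1}^n U_i\chi_{[a_i,b_i)}(t)$ with $0\le a_i\le b_i$ and $U_i\in\mathcal A_{X,\Delta}(a_i)$; let $\mathcal B_2$ be the Hilbert space completion of the space of simple adapted processes for $\langle U,V\rangle=\int_0^\infty\langle U(t),V(t)\rangle_\phi\,dt$. Define $$\int_0^\infty U(t)\,dX(t)=\sum_{i=1}^nU_iX([a_i,b_i)),\qquad \int_0^\infty dX(t)\,U(t)=\sum_{i=1}^nX([a_i,b_i))U_i .$$ Then for all simple adapted processes $U,V$ $$\Bigl\langle\int_0^\infty dX(t)\,U(t),\int_0^\infty dX(t)\,V(t)\Bigr\rangle_\phi=r_2\int_0^\infty\langle U(t),V(t)\rangle_\phi\,dt=\Bigl\langle\int_0^\infty U(t)\,dX(t),\int_0^\infty V(t)\,dX(t)\Bigr\rangle_\phi .$$ Consequently each of the maps $U\mapsto\int_0^\infty dX(t)\,U(t)$ and $U\mapsto\int_0^\infty U(t)\,dX(t)$ is well defined with values in $\mathcal A_{X,\Delta}$ and has a unique extension to a continuous linear map $J:\mathcal B_2\to L^2(\mathcal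 A_{X,\Delta},\phi)$, and this extension satisfies $\langle Ju,Jv\rangle_\phi=r_2\langle u,v\rangle$ for all $u,v\in\mathcal B_2$. -/

import Mathlib

open MeasureTheory Set UniformSpace
open scoped TensorProduct ComplexConjugate InnerProductSpace DirectSum

noncomputable section

namespace QFock

universe u

section Algebraic

variable {H : Type u} [NormedAddCommGroup H] [InnerProductSpace ℂ H]

/-- The linear functional `η₁ ⊗ ⋯ ⊗ ηₙ ↦ ∏ ⟨ξₖ, ηₖ⟩` on the `n`-particle space. -/
def pairing {n : ℕ} (ξ : Fin n → H) : (⨂[ℂ]^n H) →ₗ[ℂ] ℂ :=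
  PiTensorProduct.lift
    ((MultilinearMap.mkPiAlgebra ℂ (Fin n) ℂ).compLinearMap
      fun k => (innerSL ℂ (ξ k)).toLinearMap)

theorem pairing_tprod {n : ℕ} (ξ η : Fin n → H) :
    pairing ξ (PiTensorProduct.tprod ℂ η) = ∏ k, ⟪ξ k, η k⟫_ℂ := by
  simp [pairing]

theorem conj_pairing_tprod {n : ℕ} (ξ η : Fin n → H) :
    conj (pairing ξ (PiTensorProduct.tprod ℂ η)) = ∏ k, ⟪η k, ξ k⟫_ℂ := by
  simp [pairing_tprod, map_prod, inner_conj_symm]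

/-- The conjugate-linear functional `ξ ↦ conj ⟨η₁ ⊗ ⋯ ⊗ ηₙ, ξ⟩`. -/
def conjPairing {n : ℕ} (η : Fin n → H) : (⨂[ℂ]^n H) →ₗ⋆[ℂ] ℂ where
  toFun x := conj (pairing η x)
  map_add' x y := by simp
  map_smul' c x := by simp

theorem conjPairing_tprod {n : ℕ} (η ξ : Fin n → H) :
    conjPairing η (PiTensorProduct.tprod ℂ ξ) = ∏ k, ⟪ξ k, η k⟫_ℂ :=
  conj_pairing_tprod η ξ

theorem conjPairing_ext {n : ℕ} {f g : (⨂[ℂ]^n H) →ₗ⋆[ℂ] ℂ}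
    (h : ∀ ξ : Fin n → H, f (PiTensorProduct.tprod ℂ ξ) = g (PiTensorProduct.tprod ℂ ξ)) :
    f = g := by
  ext x
  induction x using PiTensorProduct.induction_on with
  | smul_tprod r ξ => simp [h]
  | add x y hx hy => simp [hx, hy]

/-- `conjPairing` as a multilinear map in the tensor factors. -/
def conjPairingMultilinear (n : ℕ) :
    MultilinearMap ℂ (fun _ : Fin n => H) ((⨂[ℂ]^n H) →ₗ⋆[ℂ] ℂ) where
  toFun η := conjPairing η
  map_update_add' η i x y := by
    refine conjPairing_ext fun ξ => ?_
    rw [LinearMap.add_apply]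
    simp only [conjPairing_tprod]
    have := ((MultilinearMap.mkPiAlgebra ℂ (Fin n) ℂ).compLinearMap
      fun k => (innerSL ℂ (ξ k)).toLinearMap).map_update_add η i x y
    simpa only [MultilinearMap.compLinearMap_apply, MultilinearMap.mkPiAlgebra_apply,
      ContinuousLinearMap.coe_coe, innerSL_apply_apply] using this
  map_update_smul' η i c x := by
    refine conjPairing_ext fun ξ => ?_
    rw [LinearMap.smul_apply]
    simp only [conjPairing_tprod]
    have := ((MultilinearMap.mkPiAlgebra ℂ (Fin n) ℂ).compLinearMap
      fun k => (innerSL ℂ (ξ k)).toLinearMap).map_update_smul η i c x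
    simpa only [MultilinearMap.compLinearMap_apply, MultilinearMap.mkPiAlgebra_apply,
      ContinuousLinearMap.coe_coe, innerSL_apply_apply] using this

/-- The usual inner product on the `n`-particle space, conjugate-linear in the first variable:
`⟨ξ₁ ⊗ ⋯ ⊗ ξₙ, η₁ ⊗ ⋯ ⊗ ηₙ⟩₀ = ∏ ⟨ξₖ, ηₖ⟩`. -/
def tensorInner (n : ℕ) : (⨂[ℂ]^n H) →ₗ⋆[ℂ] (⨂[ℂ]^n H) →ₗ[ℂ] ℂ :=
  (PiTensorProduct.lift (conjPairingMultilinear (H := H) n)).flip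

theorem tensorInner_tprod {n : ℕ} (ξ η : Fin n → H) :
    tensorInner n (PiTensorProduct.tprod ℂ ξ) (PiTensorProduct.tprod ℂ η)
      = ∏ k, ⟪ξ k, η k⟫_ℂ := by
  simp only [tensorInner, LinearMap.flip_apply, PiTensorProduct.lift.tprod]
  exact conjPairing_tprod η ξ

/-- The number of inversions of a permutation. -/
def inversions {n : ℕ} (σ : Equiv.Perm (Fin n)) : ℕ :=
  (Finset.univ.filter fun p : Fin n × Fin n => p.1 < p.2 ∧ σ p.2 < σ p.1).card

/-- `ξ₁ ⊗ ⋯ ⊗ ξₙ ↦ ξ_{σ(1)} ⊗ ⋯ ⊗ ξ_{σ(n)}`. -/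
def permute {n : ℕ} (σ : Equiv.Perm (Fin n)) : (⨂[ℂ]^n H) →ₗ[ℂ] (⨂[ℂ]^n H) :=
  PiTensorProduct.lift ((PiTensorProduct.tprod ℂ).domDomCongr σ)

theorem permute_tprod {n : ℕ} (σ : Equiv.Perm (Fin n)) (ξ : Fin n → H) :
    permute σ (PiTensorProduct.tprod ℂ ξ) = PiTensorProduct.tprod ℂ fun k => ξ (σ k) := by
  simp [permute]

/-- The operator `Pₙ = ∑_σ q^{i(σ)} σ` on the `n`-particle space. -/
def qSymm (q : ℝ) (n : ℕ) : (⨂[ℂ]^n H) →ₗ[ℂ] (⨂[ℂ]^n H) :=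
  ∑ σ : Equiv.Perm (Fin n), ((q : ℂ) ^ inversions σ) • permute σ

/-- The algebraic Fock space `⨁ₙ H^{⊗ n}`. -/
abbrev AlgFock (H : Type u) [NormedAddCommGroup H] [InnerProductSpace ℂ H] : Type u :=
  ⨁ n : ℕ, ⨂[ℂ]^n H

/-- The `q`-inner product `⟨v, w⟩_q = ⟨v, P w⟩₀` on the algebraic Fock space (a finite sum). -/
def qInner (q : ℝ) (v w : AlgFock H) : ℂ :=
  ∑ᶠ n : ℕ, tensorInner n (v n) (qSymm q n (w n))

/-! ### Positivity of the `q`-inner product -/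

theorem tensorInner_conj {n : ℕ} (x y : ⨂[ℂ]^n H) :
    conj (tensorInner n x y) = tensorInner n y x := by
  induction x using PiTensorProduct.induction_on with
  | smul_tprod r ξ =>
    induction y using PiTensorProduct.induction_on with
    | smul_tprod s η =>
      simp only [map_smulₛₗ, LinearMap.smul_apply, smul_eq_mul, map_mul, tensorInner_tprod,
        map_prod, inner_conj_symm, RingHom.id_apply, Complex.conj_conj]
      ring
    | add y z hy hz => simp only [map_add, LinearMap.add_apply, hy, hz]
  | add x z hx hz => simp only [map_add, LinearMap.add_apply, hx, hz]

theorem exists_sum_tprod {n : ℕ} (x : ⨂[ℂ]^n H) :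
    ∃ (m : ℕ) (c : Fin m → ℂ) (ξ : Fin m → Fin n → H),
      x = ∑ i, c i • PiTensorProduct.tprod ℂ (ξ i) := by
  induction x using PiTensorProduct.induction_on with
  | smul_tprod r ξ => exact ⟨1, fun _ => r, fun _ => ξ, by simp⟩
  | add x y hx hy =>
    obtain ⟨m, c, ξ, rfl⟩ := hx
    obtain ⟨k, d, η, rfl⟩ := hy
    exact ⟨m + k, Fin.append c d, Fin.append ξ η, by simp [Fin.sum_univ_add]⟩

open scoped ComplexOrder in
theorem posSemidef_prod_gram {n m : ℕ} (ξ : Fin m → Fin n → H) (s : Finset (Fin n)) :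
    (Matrix.of fun i j => ∏ k ∈ s, ⟪ξ i k, ξ j k⟫_ℂ).PosSemidef := by
  classical
  induction s using Finset.induction_on with
  | empty =>
    have h := Matrix.posSemidef_gram ℂ (fun _ : Fin m => (1 : ℂ))
    have e : (Matrix.of fun i j => ∏ k ∈ (∅ : Finset (Fin n)), ⟪ξ i k, ξ j k⟫_ℂ) =
        Matrix.gram ℂ (fun _ : Fin m => (1 : ℂ)) := by
      ext i j
      simp [Matrix.gram_apply]
    rw [e]
    exact h
  | insert a s ha ih =>
    have h := (Matrix.posSemidef_gram ℂ (fun i : Fin m => ξ i a)).hadamard ih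
    have e : (Matrix.of fun i j => ∏ k ∈ insert a s, ⟪ξ i k, ξ j k⟫_ℂ) =
        (Matrix.gram ℂ fun i : Fin m => ξ i a).hadamard
          (Matrix.of fun i j => ∏ k ∈ s, ⟪ξ i k, ξ j k⟫_ℂ) := by
      ext i j
      simp [Finset.prod_insert ha, Matrix.gram_apply]
    rw [e]
    exact h

open scoped ComplexOrder in
theorem tensorInner_self_nonneg {n : ℕ} (x : ⨂[ℂ]^n H) : 0 ≤ (tensorInner n x x).re := by
  obtain ⟨m, c, ξ, rfl⟩ := exists_sum_tprod x
  have h := (posSemidef_prod_gram ξ Finset.univ).dotProduct_mulVec_nonneg c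
  have h2 : tensorInner n (∑ i, c i • PiTensorProduct.tprod ℂ (ξ i))
      (∑ i, c i • PiTensorProduct.tprod ℂ (ξ i)) =
      star c ⬝ᵥ (Matrix.of fun i j => ∏ k, ⟪ξ i k, ξ j k⟫_ℂ).mulVec c := by
    simp only [map_sum, LinearMap.sum_apply, map_smulₛₗ, LinearMap.smul_apply, tensorInner_tprod,
      dotProduct, Matrix.mulVec, Matrix.of_apply, Pi.star_apply, Finset.mul_sum, smul_eq_mul,
      RingHom.id_apply, RCLike.star_def]
    rw [Finset.sum_comm]
    refine Finset.sum_congr rfl fun i _ => Finset.sum_congr rfl fun j _ => ?_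
    ring
  rw [h2]
  exact (Complex.le_def.1 h).1

theorem permute_mul {n : ℕ} (σ τ : Equiv.Perm (Fin n)) (x : ⨂[ℂ]^n H) :
    permute σ (permute τ x) = permute (τ * σ) x := by
  induction x using PiTensorProduct.induction_on with
  | smul_tprod r ξ => simp [permute_tprod]
  | add x y hx hy => simp only [map_add, hx, hy]

theorem tensorInner_permute {n : ℕ} (σ : Equiv.Perm (Fin n)) (x y : ⨂[ℂ]^n H) :
    tensorInner n (permute σ x) (permute σ y) = tensorInner n x y := by
  induction x using PiTensorProduct.induction_on with
  | smul_tprod r ξ =>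
    induction y using PiTensorProduct.induction_on with
    | smul_tprod s η =>
      simp only [map_smulₛₗ, LinearMap.smul_apply, permute_tprod, tensorInner_tprod,
        RingHom.id_apply]
      rw [Equiv.prod_comp σ fun k => ⟪ξ k, η k⟫_ℂ]
    | add y z hy hz => simp only [map_add, hy, hz]
  | add x z hx hz => simp only [map_add, LinearMap.add_apply, hx, hz]

/-- `±1` according to the relative order of `σ u` and `σ v`. -/
def orderSign {n : ℕ} (p : Fin n × Fin n) (σ : Equiv.Perm (Fin n)) : ℝ :=
  if σ p.1 < σ p.2 then 1 else -1

theorem inversions_mul_inv {n : ℕ} (ρ τ : Equiv.Perm (Fin n)) :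
    inversions (ρ * τ⁻¹) =
      ((Finset.univ.filter fun p : Fin n × Fin n => p.1 < p.2).filter
        fun p => orderSign p τ ≠ orderSign p ρ).card := by
  unfold inversions
  symm
  refine Finset.card_bij
    (fun p _ => if τ p.1 < τ p.2 then (τ p.1, τ p.2) else (τ p.2, τ p.1)) ?_ ?_ ?_
  · rintro ⟨u, v⟩ h
    rw [Finset.mem_filter, Finset.mem_filter] at h
    obtain ⟨⟨-, huv⟩, h⟩ := h
    dsimp only at huv
    simp only [orderSign] at h
    have hne : u ≠ v := huv.ne
    have h1 : τ u ≠ τ v := fun e => hne (τ.injective e)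
    have h2 : ρ u ≠ ρ v := fun e => hne (ρ.injective e)
    by_cases ht : τ u < τ v
    · simp only [ht, if_true] at h ⊢
      have : ¬ ρ u < ρ v := fun hr => h (by simp [hr])
      refine Finset.mem_filter.2 ⟨Finset.mem_univ _, ht, ?_⟩
      simpa using lt_of_le_of_ne (not_lt.1 this) h2.symm
    · simp only [ht, if_false] at h ⊢
      have : ρ u < ρ v := by
        by_contra hr
        exact h (by simp [hr])
      refine Finset.mem_filter.2 ⟨Finset.mem_univ _, lt_of_le_of_ne (not_lt.1 ht) h1.symm, ?_⟩
      simpa using this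
  · rintro ⟨u, v⟩ h ⟨u', v'⟩ h' e
    simp only [Finset.mem_filter, Finset.mem_univ, true_and] at h h'
    have h1 := h.1
    have h2 := h'.1
    dsimp only at e
    split_ifs at e <;> simp only [Prod.mk.injEq, EmbeddingLike.apply_eq_iff_eq] at e <;>
      obtain ⟨rfl, rfl⟩ := e <;> first | rfl | exact absurd h1 h2.asymm
  · rintro ⟨i, j⟩ h
    rw [Finset.mem_filter] at h
    obtain ⟨-, hij, hr⟩ := h
    simp only [Equiv.Perm.mul_apply] at hij hr
    rcases lt_trichotomy (τ⁻¹ i) (τ⁻¹ j) with hlt | heq | hgt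
    · have e1 : τ (τ⁻¹ i) = i := τ.apply_symm_apply i
      have e2 : τ (τ⁻¹ j) = j := τ.apply_symm_apply j
      refine ⟨(τ⁻¹ i, τ⁻¹ j), Finset.mem_filter.2
        ⟨Finset.mem_filter.2 ⟨Finset.mem_univ _, hlt⟩, ?_⟩, ?_⟩
      · unfold orderSign
        dsimp only
        rw [e1, e2, if_pos hij, if_neg hr.asymm]
        norm_num
      · dsimp only
        rw [e1, e2, if_pos hij]
    · exact absurd (τ⁻¹.injective heq) hij.ne
    · have e1 : τ (τ⁻¹ i) = i := τ.apply_symm_apply i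
      have e2 : τ (τ⁻¹ j) = j := τ.apply_symm_apply j
      refine ⟨(τ⁻¹ j, τ⁻¹ i), Finset.mem_filter.2
        ⟨Finset.mem_filter.2 ⟨Finset.mem_univ _, hgt⟩, ?_⟩, ?_⟩
      · unfold orderSign
        dsimp only
        rw [e1, e2, if_neg hij.asymm, if_pos hr]
        norm_num
      · dsimp only
        rw [e1, e2, if_neg hij.asymm]

theorem inversions_inv {n : ℕ} (σ : Equiv.Perm (Fin n)) : inversions σ⁻¹ = inversions σ := by
  have h1 := inversions_mul_inv 1 σ
  have h2 := inversions_mul_inv σ 1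
  simp only [one_mul, inv_one, mul_one] at h1 h2
  rw [h1, h2]
  simp only [ne_comm]

theorem sum_prod_nonneg {n : ℕ} {q : ℝ} (hq : q ∈ Icc (-1 : ℝ) 1)
    (s : Finset (Fin n × Fin n)) (x : Equiv.Perm (Fin n) → ⨂[ℂ]^n H) :
    0 ≤ (∑ τ, ∑ ρ, ((∏ p ∈ s, if orderSign p τ ≠ orderSign p ρ then q else 1 : ℝ) : ℂ) *
      tensorInner n (x τ) (x ρ)).re := by
  classical
  induction s using Finset.induction_on generalizing x with
  | empty =>
    have h := tensorInner_self_nonneg (∑ τ, x τ)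
    simp only [map_sum, LinearMap.sum_apply] at h
    rw [Finset.sum_comm] at h
    simpa using h
  | insert a s ha ih =>
    have h1 := ih x
    have h2 := ih fun τ => (orderSign a τ : ℂ) • x τ
    have key : (∑ τ, ∑ ρ, ((∏ p ∈ insert a s,
          if orderSign p τ ≠ orderSign p ρ then q else 1 : ℝ) : ℂ) *
            tensorInner n (x τ) (x ρ)) =
        (((1 + q) / 2 : ℝ) : ℂ) * (∑ τ, ∑ ρ, ((∏ p ∈ s,
          if orderSign p τ ≠ orderSign p ρ then q else 1 : ℝ) : ℂ) *
            tensorInner n (x τ) (x ρ)) +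
        (((1 - q) / 2 : ℝ) : ℂ) * (∑ τ, ∑ ρ, ((∏ p ∈ s,
          if orderSign p τ ≠ orderSign p ρ then q else 1 : ℝ) : ℂ) *
            tensorInner n ((orderSign a τ : ℂ) • x τ) ((orderSign a ρ : ℂ) • x ρ)) := by
      simp only [Finset.mul_sum, ← Finset.sum_add_distrib]
      refine Finset.sum_congr rfl fun τ _ => Finset.sum_congr rfl fun ρ _ => ?_
      rw [Finset.prod_insert ha]
      simp only [map_smulₛₗ, LinearMap.smul_apply, smul_eq_mul, Complex.conj_ofReal,
        RingHom.id_apply]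
      have : (if orderSign a τ ≠ orderSign a ρ then q else 1) =
          (1 + q) / 2 + (1 - q) / 2 * (orderSign a τ * orderSign a ρ) := by
        unfold orderSign
        by_cases h1 : τ a.1 < τ a.2 <;> by_cases h2 : ρ a.1 < ρ a.2 <;>
          norm_num [h1, h2] <;> ring
      rw [this]
      push_cast
      ring
    rw [key, Complex.add_re, Complex.re_ofReal_mul, Complex.re_ofReal_mul]
    have := hq.1
    have := hq.2
    have ha : 0 ≤ (1 + q) / 2 := by linarith
    have hb : 0 ≤ (1 - q) / 2 := by linarith
    exact add_nonneg (mul_nonneg ha h1) (mul_nonneg hb h2)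

theorem qSymm_conj (q : ℝ) {n : ℕ} (x y : ⨂[ℂ]^n H) :
    conj (tensorInner n y (qSymm q n x)) = tensorInner n x (qSymm q n y) := by
  simp only [qSymm, LinearMap.sum_apply, LinearMap.smul_apply, map_sum, map_smulₛₗ,
    smul_eq_mul, map_mul, RingHom.id_apply, tensorInner_conj, map_pow, Complex.conj_ofReal]
  refine Fintype.sum_equiv (Equiv.inv _) _ _ fun σ => ?_
  rw [Equiv.inv_apply, inversions_inv, ← tensorInner_permute σ⁻¹, permute_mul]
  simp only [mul_inv_cancel]
  congr 3
  induction x using PiTensorProduct.induction_on with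
  | smul_tprod r ξ => simp [permute_tprod]
  | add x y hx hy => simp only [map_add, hx, hy]

theorem qSymm_nonneg {q : ℝ} (hq : q ∈ Icc (-1 : ℝ) 1) {n : ℕ} (x : ⨂[ℂ]^n H) :
    0 ≤ (tensorInner n x (qSymm q n x)).re := by
  have h := sum_prod_nonneg hq (Finset.univ.filter fun p : Fin n × Fin n => p.1 < p.2)
    fun τ => permute τ x
  have key : (∑ τ, ∑ ρ, ((∏ p ∈ Finset.univ.filter fun p : Fin n × Fin n => p.1 < p.2,
      if orderSign p τ ≠ orderSign p ρ then q else 1 : ℝ) : ℂ) *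
      tensorInner n (permute τ x) (permute ρ x)) =
      ((Fintype.card (Equiv.Perm (Fin n)) : ℝ) : ℂ) * tensorInner n x (qSymm q n x) := by
    rw [show ((Fintype.card (Equiv.Perm (Fin n)) : ℝ) : ℂ) * tensorInner n x (qSymm q n x)
      = ∑ _τ : Equiv.Perm (Fin n), tensorInner n x (qSymm q n x) by simp]
    refine Finset.sum_congr rfl fun τ _ => ?_
    simp only [qSymm, LinearMap.sum_apply, LinearMap.smul_apply, map_sum, map_smulₛₗ,
      smul_eq_mul, RingHom.id_apply]
    symm
    refine Fintype.sum_equiv (Equiv.mulRight τ) _ _ fun σ => ?_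
    rw [Equiv.coe_mulRight, ← permute_mul, tensorInner_permute]
    congr 1
    rw [← Finset.prod_filter, Finset.prod_const, ← inversions_mul_inv]
    simp
  rw [key, Complex.re_ofReal_mul] at h
  refine nonneg_of_mul_nonneg_right h ?_
  exact_mod_cast Fintype.card_pos

theorem qInner_finite (q : ℝ) (v w : AlgFock H) :
    (Function.support fun n => tensorInner n (v n) (qSymm q n (w n))).Finite := by
  classical
  refine (DFinsupp.support v).finite_toSet.subset fun n hn => ?_
  simp only [Function.mem_support] at hn
  simp only [Finset.mem_coe, DFinsupp.mem_support_toFun]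
  intro h0
  apply hn
  rw [show v n = 0 from h0]
  simp

/-- The `q`-inner product is a positive semidefinite Hermitian form for `q ∈ [-1, 1]`. -/
abbrev qCore {q : ℝ} (hq : q ∈ Icc (-1 : ℝ) 1) : PreInnerProductSpace.Core ℂ (AlgFock H) where
  inner v w := qInner q v w
  conj_inner_symm v w := by
    unfold qInner
    have h := AddMonoidHom.map_finsum (starRingEnd ℂ).toAddMonoidHom (qInner_finite q w v)
    simp only [RingHom.toAddMonoidHom_eq_coe, AddMonoidHom.coe_coe] at h
    rw [h]
    exact finsum_congr fun n => qSymm_conj q (v n) (w n)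
  re_inner_nonneg v := by
    unfold qInner
    have h := AddMonoidHom.map_finsum Complex.reAddGroupHom (qInner_finite q v v)
    simp only [Complex.coe_reAddGroupHom] at h
    rw [RCLike.re_eq_complex_re, h]
    exact finsum_nonneg fun n => qSymm_nonneg hq (v n)
  add_left u v w := by
    unfold qInner
    rw [← finsum_add_distrib (qInner_finite q u w) (qInner_finite q v w)]
    simp [DirectSum.add_apply]
  smul_left v w c := by
    unfold qInner
    rw [← smul_eq_mul, smul_finsum]
    simp [DirectSum.smul_apply]

/-! ### Creation, annihilation and gauge operators on the algebraic Fock space -/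

/-- Creation: `η₁ ⊗ ⋯ ⊗ ηₙ ↦ ζ ⊗ η₁ ⊗ ⋯ ⊗ ηₙ`; in particular `Ω ↦ ζ`. -/
def creation (ζ : H) : AlgFock H →ₗ[ℂ] AlgFock H :=
  DirectSum.toModule ℂ ℕ _ fun n =>
    DirectSum.lof ℂ ℕ (fun n => ⨂[ℂ]^n H) (n + 1) ∘ₗ
      PiTensorProduct.lift
        ((PiTensorProduct.tprod ℂ : MultilinearMap ℂ (fun _ : Fin (n + 1) => H) _).curryLeft ζ)

/-- Annihilation: `Ω ↦ 0` and
`η₁ ⊗ ⋯ ⊗ ηₙ ↦ ∑ₖ q^{k-1} ⟨ζ, ηₖ⟩ η₁ ⊗ ⋯ ⊗ η̌ₖ ⊗ ⋯ ⊗ ηₙ`. -/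
def annihilation (q : ℝ) (ζ : H) : AlgFock H →ₗ[ℂ] AlgFock H :=
  DirectSum.toModule ℂ ℕ _ fun
    | 0 => 0
    | n + 1 =>
      DirectSum.lof ℂ ℕ (fun n => ⨂[ℂ]^n H) n ∘ₗ
        PiTensorProduct.lift (∑ k : Fin (n + 1), ((q : ℂ) ^ (k : ℕ)) •
          LinearMap.uncurryMid k ((innerSL ℂ ζ).toLinearMap.smulRight
            (PiTensorProduct.tprod ℂ : MultilinearMap ℂ (fun _ : Fin n => H) _)))

/-- Gauge (preservation) operator: `Ω ↦ 0` and
`η₁ ⊗ ⋯ ⊗ ηₙ ↦ ∑ₖ q^{k-1} (T ηₖ) ⊗ η₁ ⊗ ⋯ ⊗ η̌ₖ ⊗ ⋯ ⊗ ηₙ`. -/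
def gauge (q : ℝ) (T : H →L[ℂ] H) : AlgFock H →ₗ[ℂ] AlgFock H :=
  DirectSum.toModule ℂ ℕ _ fun
    | 0 => 0
    | n + 1 =>
      DirectSum.lof ℂ ℕ (fun n => ⨂[ℂ]^n H) (n + 1) ∘ₗ
        PiTensorProduct.lift (∑ k : Fin (n + 1), ((q : ℂ) ^ (k : ℕ)) •
          LinearMap.uncurryMid k
            ((PiTensorProduct.tprod ℂ :
              MultilinearMap ℂ (fun _ : Fin (n + 1) => H) _).curryLeft ∘ₗ T.toLinearMap))

/-- The tensor `η₁ ⊗ ⋯ ⊗ ηₙ` as an element of the algebraic Fock space. -/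
def word {n : ℕ} (η : Fin n → H) : AlgFock H :=
  DirectSum.lof ℂ ℕ (fun n => ⨂[ℂ]^n H) n (PiTensorProduct.tprod ℂ η)

theorem creation_word (ζ : H) {n : ℕ} (η : Fin n → H) :
    creation ζ (word η) = word (Fin.cons ζ η) := by
  simp [creation, word]

theorem annihilation_vacuum (q : ℝ) (ζ : H) (η : Fin 0 → H) :
    annihilation q ζ (word η) = 0 := by
  simp [annihilation, word]

theorem annihilation_word (q : ℝ) (ζ : H) {n : ℕ} (η : Fin (n + 1) → H) :
    annihilation q ζ (word η) =
      ∑ k : Fin (n + 1), ((q : ℂ) ^ (k : ℕ) * ⟪ζ, η k⟫_ℂ) • word (k.removeNth η) := by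
  simp [annihilation, word, mul_smul]

theorem gauge_vacuum (q : ℝ) (T : H →L[ℂ] H) (η : Fin 0 → H) :
    gauge q T (word η) = 0 := by
  simp [gauge, word]

theorem gauge_word (q : ℝ) (T : H →L[ℂ] H) {n : ℕ} (η : Fin (n + 1) → H) :
    gauge q T (word η) =
      ∑ k : Fin (n + 1), ((q : ℂ) ^ (k : ℕ)) • word (Fin.cons (T (η k)) (k.removeNth η)) := by
  simp [gauge, word]

end Algebraic

/-! ### The `q`-Fock space -/

/-- The algebraic Fock space, to be normed by the `q`-inner product, `q ∈ (-1, 1)`. -/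
def PreFock (_q : Ioo (-1 : ℝ) 1) (H : Type u) [NormedAddCommGroup H] [InnerProductSpace ℂ H] :
    Type u :=
  AlgFock H

section Completed

variable (q : Ioo (-1 : ℝ) 1) (H : Type u) [NormedAddCommGroup H] [InnerProductSpace ℂ H]

instance : AddCommGroup (PreFock q H) := inferInstanceAs (AddCommGroup (AlgFock H))
instance : Module ℂ (PreFock q H) := inferInstanceAs (Module ℂ (AlgFock H))

abbrev preFockCore : PreInnerProductSpace.Core ℂ (PreFock q H) :=
  qCore (H := H) (q := (q : ℝ)) ⟨q.2.1.le, q.2.2.le⟩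

instance : SeminormedAddCommGroup (PreFock q H) :=
  InnerProductSpace.Core.toSeminormedAddCommGroup (c := preFockCore q H)
instance : InnerProductSpace ℂ (PreFock q H) := InnerProductSpace.ofCore (preFockCore q H)

/-- The `q`-Fock space: the Hilbert space completion of the algebraic Fock space with respect to
the `q`-inner product. -/
abbrev FockSpace : Type u := Completion (PreFock q H)

variable {H}

/-- The canonical map from the algebraic Fock space to its completion. -/
def toFock : AlgFock H →ₗ[ℂ] FockSpace q H :=
  (Completion.toComplL (𝕜 := ℂ) (E := PreFock q H)).toLinearMap

theorem inner_toFock (v w : AlgFock H) : ⟪toFock q v, toFock q w⟫_ℂ = qInner (q : ℝ) v w :=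
  Completion.inner_coe (𝕜 := ℂ) (E := PreFock q H) v w

/-- The vacuum vector. -/
def vacuum : FockSpace q H := toFock q (word (Fin.elim0 : Fin 0 → H))

/-- The operator `p(ζ, T) = a(ζ) + a*(ζ) + p(T)` on the `q`-Fock space: the continuous extension
of the corresponding operator on the algebraic Fock space, which is bounded for the `q`-norm. -/
def fieldOperator (ζ : H) (T : H →L[ℂ] H) : FockSpace q H →L[ℂ] FockSpace q H :=
  (toFock q ∘ₗ (annihilation (q : ℝ) ζ + creation ζ + gauge (q : ℝ) T)).extendOfNorm (toFock q)

/-- The vacuum state `φ(A) = ⟨Ω, A Ω⟩`. -/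
def vacuumState (A : FockSpace q H →L[ℂ] FockSpace q H) : ℂ :=
  ⟪vacuum q, A (vacuum q)⟫_ℂ

/-- The inner product `⟨A, B⟩_φ = φ(A* B)`. -/
def phiInner (A B : FockSpace q H →L[ℂ] FockSpace q H) : ℂ :=
  vacuumState q (star A * B)

theorem phiInner_eq (A B : FockSpace q H →L[ℂ] FockSpace q H) :
    phiInner q A B = ⟪A (vacuum q), B (vacuum q)⟫_ℂ := by
  simp [phiInner, vacuumState, ContinuousLinearMap.star_eq_adjoint,
    ContinuousLinearMap.adjoint_inner_right]

end Completed

/-! ### Von Neumann algebras and `L²(A, φ)` -/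

/-- The von Neumann algebra generated by a set `S` of bounded operators: the double commutant of
`S ∪ S*`. -/
def generatedVN {K : Type u} [NormedAddCommGroup K] [InnerProductSpace ℂ K] [CompleteSpace K]
    (S : Set (K →L[ℂ] K)) : VonNeumannAlgebra K where
  toStarSubalgebra :=
    StarSubalgebra.centralizer ℂ (StarSubalgebra.centralizer ℂ S : Set (K →L[ℂ] K))
  centralizer_centralizer' := by
    simp

theorem subset_generatedVN {K : Type u} [NormedAddCommGroup K] [InnerProductSpace ℂ K]
    [CompleteSpace K] (S : Set (K →L[ℂ] K)) : S ⊆ generatedVN S := by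
  intro A hA
  change A ∈ StarSubalgebra.centralizer ℂ (StarSubalgebra.centralizer ℂ S : Set (K →L[ℂ] K))
  rw [StarSubalgebra.mem_centralizer_iff]
  intro B hB
  have hB1 := (StarSubalgebra.mem_centralizer_iff ℂ).1 (SetLike.mem_coe.1 hB) A hA
  have hB2 := (StarSubalgebra.mem_centralizer_iff ℂ).1
    (star_mem (SetLike.mem_coe.1 hB)) A hA
  exact ⟨hB1.1.symm, hB2.1.symm⟩

theorem generatedVN_le {K : Type u} [NormedAddCommGroup K] [InnerProductSpace ℂ K]
    [CompleteSpace K] (S : Set (K →L[ℂ] K)) (A : VonNeumannAlgebra K)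
    (h : S ⊆ A) : generatedVN S ≤ A := by
  intro B hB
  rw [← SetLike.mem_coe, ← A.centralizer_centralizer]
  change B ∈ StarSubalgebra.centralizer ℂ (StarSubalgebra.centralizer ℂ S : Set (K →L[ℂ] K)) at hB
  rw [StarSubalgebra.mem_centralizer_iff] at hB
  intro C hC
  refine (hB C ?_).1
  rw [SetLike.mem_coe, StarSubalgebra.mem_centralizer_iff]
  intro D hD
  exact ⟨hC D (h hD), hC (star D) (star_mem (h hD))⟩

section L2

variable {q : Ioo (-1 : ℝ) 1} {H : Type u} [NormedAddCommGroup H] [InnerProductSpace ℂ H]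

/-- A von Neumann algebra on the `q`-Fock space, to be normed by `⟨·, ·⟩_φ`. -/
def PreL2 (A : VonNeumannAlgebra (FockSpace q H)) : Type u := A.toStarSubalgebra

instance (A : VonNeumannAlgebra (FockSpace q H)) : AddCommGroup (PreL2 A) :=
  inferInstanceAs (AddCommGroup A.toStarSubalgebra)
instance (A : VonNeumannAlgebra (FockSpace q H)) : Module ℂ (PreL2 A) :=
  inferInstanceAs (Module ℂ A.toStarSubalgebra)

/-- The underlying operator. -/
def PreL2.op {A : VonNeumannAlgebra (FockSpace q H)} (a : PreL2 A) :
    FockSpace q H →L[ℂ] FockSpace q H :=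
  (show A.toStarSubalgebra from a).1

abbrev preL2Core (A : VonNeumannAlgebra (FockSpace q H)) :
    PreInnerProductSpace.Core ℂ (PreL2 A) where
  inner a b := phiInner q a.op b.op
  conj_inner_symm a b := by simp [phiInner_eq, inner_conj_symm]
  re_inner_nonneg a := by
    rw [phiInner_eq]
    exact inner_self_nonneg
  add_left a b c := by
    have : (a + b).op = a.op + b.op := rfl
    simp [phiInner_eq, this, inner_add_left]
  smul_left a b r := by
    have : (r • a).op = r • a.op := rfl
    simp [phiInner_eq, this, inner_smul_left]

instance (A : VonNeumannAlgebra (FockSpace q H)) : SeminormedAddCommGroup (PreL2 A) :=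
  InnerProductSpace.Core.toSeminormedAddCommGroup (c := preL2Core A)
instance (A : VonNeumannAlgebra (FockSpace q H)) : InnerProductSpace ℂ (PreL2 A) :=
  InnerProductSpace.ofCore (preL2Core A)

/-- `L²(A, φ)`: the Hilbert space completion of `A` with respect to `⟨·, ·⟩_φ`. -/
abbrev L2 (A : VonNeumannAlgebra (FockSpace q H)) : Type u := Completion (PreL2 A)

/-- The class in `L²(A, φ)` of an operator belonging to `A`. -/
def toL2 (A : VonNeumannAlgebra (FockSpace q H)) (B : FockSpace q H →L[ℂ] FockSpace q H)
    (hB : B ∈ A) : L2 A :=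
  ((show PreL2 A from (⟨B, hB⟩ : A.toStarSubalgebra) : PreL2 A) : Completion (PreL2 A))

theorem inner_toL2 (A : VonNeumannAlgebra (FockSpace q H))
    {B C : FockSpace q H →L[ℂ] FockSpace q H} (hB : B ∈ A) (hC : C ∈ A) :
    ⟪toL2 A B hB, toL2 A C hC⟫_ℂ = phiInner q B C :=
  Completion.inner_coe (𝕜 := ℂ) (E := PreL2 A) _ _

end L2

end QFock

namespace QLevy

open QFock

/-- The measure `ν` on the real line is concentrated on a compact set. -/
class IsCompactlySupported (ν : Measure ℝ) : Prop where
  exists_compact : ∃ K : Set ℝ, IsCompact K ∧ ν Kᶜ = 0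

/-- The numbers `r₁ = 0` and `r_{k+2} = ∫ x^k dν`; in particular `r₂ = ν(ℝ)`. -/
def r (ν : Measure ℝ) : ℕ → ℝ
  | 0 => 0
  | 1 => 0
  | k + 2 => ∫ x, x ^ k ∂ν

/-- Lebesgue measure on `[0, ∞)`, as a measure on the real line. -/
abbrev timeMeasure : Measure ℝ := volume.restrict (Ici 0)

/-- The one-particle space `L²(ℝ₊, dt) ⊗ L²(ℝ, ν)`, realized as `L²(ℝ₊ × ℝ, dt ⊗ ν)`. -/
abbrev OneParticle (ν : Measure ℝ) : Type := Lp ℂ 2 (timeMeasure.prod ν)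

/-- The function `χ_{[a,b)} ⊗ x^k`. -/
def stepFun (k : ℕ) (a b : ℝ) : ℝ × ℝ → ℂ :=
  (Ico a b ×ˢ univ).indicator fun p => (p.2 : ℂ) ^ k

section Levy

variable (q : Ioo (-1 : ℝ) 1) (ν : Measure ℝ) [IsFiniteMeasure ν] [IsCompactlySupported ν]

theorem memLp_stepFun (k : ℕ) (a b : ℝ) (p : ENNReal) :
    MemLp (stepFun k a b) p (timeMeasure.prod ν) := by
  obtain ⟨K, hK, hν⟩ := IsCompactlySupported.exists_compact (ν := ν)
  obtain ⟨R, hR⟩ := hK.isBounded.exists_norm_le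
  have hs : MeasurableSet (Ico a b ×ˢ (univ : Set ℝ)) := measurableSet_Ico.prod .univ
  unfold stepFun
  rw [memLp_indicator_iff_restrict hs]
  have : IsFiniteMeasure ((timeMeasure.prod ν).restrict (Ico a b ×ˢ univ)) := by
    refine ⟨?_⟩
    rw [Measure.restrict_apply_univ, Measure.prod_prod]
    refine ENNReal.mul_lt_top ?_ (measure_lt_top _ _)
    exact lt_of_le_of_lt (Measure.restrict_apply_le _ _) (by simp)
  refine MemLp.of_bound (C := R ^ k) ?_ ?_
  · exact (by fun_prop : Measurable fun p : ℝ × ℝ => (p.2 : ℂ) ^ k).aestronglyMeasurable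
  · refine ae_restrict_of_ae ?_
    have h1 : ∀ᵐ x ∂ν, x ∈ K := hν
    filter_upwards [Measure.quasiMeasurePreserving_snd.ae h1] with z hz
    rw [norm_pow, Complex.norm_real]
    exact pow_le_pow_left₀ (norm_nonneg _) (hR _ hz) k

/-- The vector `χ_{[a,b)} ⊗ x^k` of the one-particle space. -/
def stepVector (k : ℕ) (a b : ℝ) : OneParticle ν :=
  (memLp_stepFun ν k a b 2).toLp _

/-- The operator of multiplication by `χ_{[a,b)} ⊗ x^k` on the one-particle space. -/
def stepMul (k : ℕ) (a b : ℝ) : OneParticle ν →L[ℂ] OneParticle ν :=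
  (ContinuousLinearMap.mul ℂ ℂ).holderL (timeMeasure.prod ν) ⊤ 2 2
    ((memLp_stepFun ν k a b ⊤).toLp _)

/-- `Y q ν k a b` is the increment over `[a, b)` of the process `Y_{k+1}` of higher diagonal
variations of the `q`-Lévy process with canonical measure `ν`, that is
`Y_{k+1}([a,b)) = p(χ_{[a,b)} ⊗ x^k, χ_{[a,b)} ⊗ x^{k+1})`. -/
def Y (k : ℕ) (a b : ℝ) :
    FockSpace q (OneParticle ν) →L[ℂ] FockSpace q (OneParticle ν) :=
  fieldOperator q (stepVector ν k a b) (stepMul ν (k + 1) a b)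

/-- The increment `X([a, b)) = Y₁([a, b))` of the `q`-Lévy process. -/
abbrev X (a b : ℝ) : FockSpace q (OneParticle ν) →L[ℂ] FockSpace q (OneParticle ν) :=
  Y q ν 0 a b

/-- The von Neumann algebra generated by `Y_k(s) = Y_k([0, s))`, `k ≥ 1`, `0 ≤ s < t`. -/
def filtration (t : ℝ) : VonNeumannAlgebra (FockSpace q (OneParticle ν)) :=
  generatedVN {A | ∃ (k : ℕ) (s : ℝ), 0 ≤ s ∧ s < t ∧ A = Y q ν k 0 s}

/-- The von Neumann algebra generated by all `Y_k(s)`, `k ≥ 1`, `s ≥ 0`. -/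
def vonNeumann : VonNeumannAlgebra (FockSpace q (OneParticle ν)) :=
  generatedVN {A | ∃ (k : ℕ) (s : ℝ), 0 ≤ s ∧ A = Y q ν k 0 s}

/-- An elementary adapted process `A χ_{[a,b)}` with `A` in the algebra at time `a`. -/
structure AdaptedStep where
  a : ℝ
  b : ℝ
  a_nonneg : 0 ≤ a
  a_le_b : a ≤ b
  op : FockSpace q (OneParticle ν) →L[ℂ] FockSpace q (OneParticle ν)
  op_mem : op ∈ filtration q ν a

variable {q ν}

/-- The simple adapted process `∑ᵢ Uᵢ χ_{[aᵢ, bᵢ)}` given by a finite list of steps (it vanishes at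
negative times). The intervals are allowed to overlap; disjoint ones give the same processes. -/
def process (U : List (AdaptedStep q ν)) (t : ℝ) :
    FockSpace q (OneParticle ν) →L[ℂ] FockSpace q (OneParticle ν) :=
  (U.map fun s => (Ico s.a s.b).indicator (fun _ => s.op) t).sum

/-- The left integral `∫ U dX = ∑ᵢ Uᵢ X([aᵢ, bᵢ))`. -/
def leftIntegral (U : List (AdaptedStep q ν)) :
    FockSpace q (OneParticle ν) →L[ℂ] FockSpace q (OneParticle ν) :=
  (U.map fun s => s.op * X q ν s.a s.b).sum

/-- The right integral `∫ dX U = ∑ᵢ X([aᵢ, bᵢ)) Uᵢ`. -/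
def rightIntegral (U : List (AdaptedStep q ν)) :
    FockSpace q (OneParticle ν) →L[ℂ] FockSpace q (OneParticle ν) :=
  (U.map fun s => X q ν s.a s.b * s.op).sum

variable (q ν)

/-- The space of simple adapted processes, as functions of time. -/
def simpleProcesses :
    Submodule ℂ (ℝ → (FockSpace q (OneParticle ν) →L[ℂ] FockSpace q (OneParticle ν))) where
  carrier := range process
  zero_mem' := ⟨[], by ext; simp [process]⟩
  add_mem' := by
    rintro _ _ ⟨U, rfl⟩ ⟨V, rfl⟩
    exact ⟨U ++ V, by ext; simp [process]⟩
  smul_mem' := by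
    rintro c _ ⟨U, rfl⟩
    refine ⟨U.map fun s => { s with
      op := c • s.op
      op_mem := (filtration q ν s.a).toStarSubalgebra.smul_mem s.op_mem c }, ?_⟩
    funext t
    induction U with
    | nil => simp [process]
    | cons s U ih =>
      simp only [process, List.map_cons, List.sum_cons, Pi.smul_apply, smul_add] at ih ⊢
      rw [ih]
      congr 1
      by_cases h : t ∈ Ico s.a s.b <;> simp [h]

/-- The space of simple adapted processes, to be normed by `∫₀^∞ ⟨U(t), V(t)⟩_φ dt`. -/
def PreB2 : Type := simpleProcesses q ν

instance : AddCommGroup (PreB2 q ν) := inferInstanceAs (AddCommGroup (simpleProcesses q ν))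
instance : Module ℂ (PreB2 q ν) := inferInstanceAs (Module ℂ (simpleProcesses q ν))

variable {q ν}

/-- The value of a simple adapted process at a time. -/
def PreB2.eval (U : PreB2 q ν) (t : ℝ) :
    FockSpace q (OneParticle ν) →L[ℂ] FockSpace q (OneParticle ν) :=
  (show simpleProcesses q ν from U).1 t

theorem integrable_process (U V : List (AdaptedStep q ν)) :
    IntegrableOn (fun t => phiInner q (process U t) (process V t)) (Ici 0) := by
  refine Integrable.integrableOn ?_
  simp only [phiInner_eq]
  induction U with
  | nil => simp [process]
  | cons s U ih =>
    have h : ∀ t, process (s :: U) t =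
        (Ico s.a s.b).indicator (fun _ => s.op) t + process U t := fun t => by simp [process]
    simp only [h, _root_.add_apply, inner_add_left]
    refine Integrable.add ?_ ih
    clear ih
    induction V with
    | nil => simp [process]
    | cons v V ih =>
      have h : ∀ t, process (v :: V) t =
          (Ico v.a v.b).indicator (fun _ => v.op) t + process V t := fun t => by simp [process]
      simp only [h, _root_.add_apply, inner_add_right]
      refine Integrable.add ?_ ih
      have e : (fun t => ⟪((Ico s.a s.b).indicator (fun _ => s.op) t) (vacuum q),
          ((Ico v.a v.b).indicator (fun _ => v.op) t) (vacuum q)⟫_ℂ) =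
          (Ico s.a s.b ∩ Ico v.a v.b).indicator
            fun _ => ⟪s.op (vacuum q), v.op (vacuum q)⟫_ℂ := by
        funext t
        by_cases h1 : t ∈ Ico s.a s.b <;> by_cases h2 : t ∈ Ico v.a v.b <;> simp [h1, h2]
      rw [e, integrable_indicator_iff (measurableSet_Ico.inter measurableSet_Ico)]
      refine integrableOn_const (ne_of_lt (lt_of_le_of_lt (measure_mono inter_subset_left) ?_))
      simp

theorem PreB2.integrable (U V : PreB2 q ν) :
    IntegrableOn (fun t => phiInner q (U.eval t) (V.eval t)) (Ici 0) := by
  obtain ⟨_, U, rfl⟩ := U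
  obtain ⟨_, V, rfl⟩ := V
  exact integrable_process U V

variable (q ν)

abbrev preB2Core : PreInnerProductSpace.Core ℂ (PreB2 q ν) where
  inner U V := ∫ t in Ici (0 : ℝ), phiInner q (U.eval t) (V.eval t)
  conj_inner_symm U V := by
    rw [← integral_conj]
    simp [phiInner_eq, inner_conj_symm]
  re_inner_nonneg U := by
    have h := integral_re (PreB2.integrable U U)
    rw [← h]
    refine integral_nonneg fun t => ?_
    simp only [phiInner_eq]
    exact inner_self_nonneg
  add_left U V W := by
    rw [← integral_add (PreB2.integrable U W) (PreB2.integrable V W)]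
    refine integral_congr_ae (.of_forall fun t => ?_)
    have : (U + V).eval t = U.eval t + V.eval t := rfl
    simp [phiInner_eq, this, inner_add_left]
  smul_left U V c := by
    rw [← integral_const_mul]
    refine integral_congr_ae (.of_forall fun t => ?_)
    have : (c • U).eval t = c • U.eval t := rfl
    simp [phiInner_eq, this, inner_smul_left]

instance : SeminormedAddCommGroup (PreB2 q ν) :=
  InnerProductSpace.Core.toSeminormedAddCommGroup (c := preB2Core q ν)
instance : InnerProductSpace ℂ (PreB2 q ν) := InnerProductSpace.ofCore (preB2Core q ν)

/-- The Hilbert space `B₂` of adapted processes. -/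
abbrev B2 : Type := Completion (PreB2 q ν)

variable {q ν}

/-- A simple adapted process as an element of `B₂`. -/
def toB2 (U : List (AdaptedStep q ν)) : B2 q ν :=
  ((show PreB2 q ν from (⟨process U, U, rfl⟩ : simpleProcesses q ν) : PreB2 q ν) :
    Completion (PreB2 q ν))

theorem inner_toB2 (U V : List (AdaptedStep q ν)) :
    ⟪toB2 U, toB2 V⟫_ℂ = ∫ t in Ici (0 : ℝ), phiInner q (process U t) (process V t) :=
  Completion.inner_coe (𝕜 := ℂ) (E := PreB2 q ν) _ _

/-- The map `J : B₂ → L²(A, φ)` takes the class of each simple adapted process `U` to the class of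
its integral `I U`, which belongs to the von Neumann algebra `A` of the process. -/
def Extends
    (I : List (AdaptedStep q ν) →
      (FockSpace q (OneParticle ν) →L[ℂ] FockSpace q (OneParticle ν)))
    (J : B2 q ν →L[ℂ] L2 (vonNeumann q ν)) : Prop :=
  ∀ U : List (AdaptedStep q ν),
    ∃ h : I U ∈ vonNeumann q ν, J (toB2 U) = toL2 (vonNeumann q ν) (I U) h

end Levy

end QLevy

end

/-! Everything reduces to two elementary steps `U χ_[a,b)` and `V χ_[c,d)` with `a ≤ c`; the
opposite order follows by Hermitian symmetry and the general case by sesquilinearity. Let `P` be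
multiplication by `χ_[0,c)`, let `Γ(P)` be its second quantization, and let `ξ = χ_[c,d) ⊗ 1`, so `P
ξ = 0`. Since `Γ(P)` commutes with every `Y_k(s)`, `s < c`, and fixes `Ω`, it commutes with the
algebra at time `c`, and `UΩ`, `VΩ` lie in its range: they are vectors over the past.

When `X` stands on the left, `X([c,d))` acts on past vectors as pure creation by `ξ`. Applying
`X([a,b)) = a(ζ) + a*(ζ) + p(T)` and compressing by `Γ(P)` kills every term that still contains the
letter `ξ`. By `a(ζ) a*(ξ) = ⟨ζ, ξ⟩ + q a*(ξ) a(ζ)` what remains is `⟨ζ, ξ⟩ Γ(P)`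
(`fockProj_field_field_fockProj`). Hence the pairing is `⟨ζ, ξ⟩ ⟨U, V⟩_φ` (`phiInner_X_mul_of_le`).

When `X` stands on the right, `X([c,d))Ω = ξ = RΩ` with `R η = Γ(P)η ⊗ ξ`. The letter `ξ` sits at
the far right and is orthogonal to the past, so `R` commutes with the algebra at time `c`. Therefore
the pairing is `⟨ζ, R U*VΩ⟩`, which sees only the vacuum component of `U*VΩ`
(`phiInner_mul_X_of_le`). No trace property of `φ` is used.

In both cases `⟨ζ, ξ⟩ = r₂ |[a,b) ∩ [c,d)|`, so intervals may overlap freely. The Gram identity then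
gives well-definedness, continuity and uniqueness of the extension by density.

The analytic input is boundedness of `p(ζ, T)` for symmetric `T`. It comes from crude geometric
bounds on words, improved to an operator bound by log-convexity of `m ↦ ‖A^m v‖` for symmetric `A`.
-/

noncomputable section

namespace QFock

universe u

/-! ### Permutations of `Fin (n + 1)` and inversions -/

/-- The permutation sending `k` to `0` and acting as `τ` on the remaining points. -/
def permInsert {n : ℕ} (k : Fin (n + 1)) (τ : Equiv.Perm (Fin n)) : Equiv.Perm (Fin (n + 1)) :=
  (finSuccEquiv' k).trans ((Equiv.optionCongr τ).trans (finSuccEquiv' 0).symm)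

@[simp] theorem permInsert_self {n : ℕ} (k : Fin (n + 1)) (τ : Equiv.Perm (Fin n)) :
    permInsert k τ k = 0 := by
  simp [permInsert]

@[simp] theorem permInsert_succAbove {n : ℕ} (k : Fin (n + 1)) (τ : Equiv.Perm (Fin n))
    (i : Fin n) : permInsert k τ (k.succAbove i) = (τ i).succ := by
  simp [permInsert]

theorem permInsert_bijective (n : ℕ) :
    Function.Bijective fun p : Fin (n + 1) × Equiv.Perm (Fin n) => permInsert p.1 p.2 := by
  rw [Fintype.bijective_iff_injective_and_card]
  refine ⟨?_, by simp [Fintype.card_perm, Nat.factorial_succ]⟩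
  rintro ⟨k, τ⟩ ⟨l, ρ⟩ h
  simp only at h
  have hk : k = l := by
    have h1 : permInsert l ρ k = 0 := by rw [← h, permInsert_self]
    exact (permInsert l ρ).injective (h1.trans (permInsert_self l ρ).symm)
  subst hk
  refine Prod.ext rfl (Equiv.ext fun i => ?_)
  have h1 := congrArg (fun e : Equiv.Perm (Fin (n + 1)) => e (k.succAbove i)) h
  simpa using h1

theorem inversions_eq_sum {n : ℕ} (σ : Equiv.Perm (Fin n)) :
    inversions σ = ∑ i, ∑ j, if i < j ∧ σ j < σ i then 1 else 0 := by
  rw [inversions, Finset.card_filter, Fintype.sum_prod_type]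

/-- The point `k` is sent to the minimum `0`, so it is inverted with exactly the `k` points to its
left and with none to its right; all other inversions are those of `τ`. -/
theorem inversions_permInsert {n : ℕ} (k : Fin (n + 1)) (τ : Equiv.Perm (Fin n)) :
    inversions (permInsert k τ) = k + inversions τ := by
  simp only [inversions_eq_sum]
  rw [Fin.sum_univ_succAbove _ k]
  simp only [permInsert_self, Fin.not_lt_zero, and_false, if_false, Finset.sum_const_zero,
    zero_add]
  have h : ∀ i : Fin n, (∑ j, if k.succAbove i < j ∧
      permInsert k τ j < permInsert k τ (k.succAbove i) then 1 else 0) =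
      (if (i : ℕ) < k then 1 else 0) + ∑ j, if i < j ∧ τ j < τ i then 1 else 0 := by
    intro i
    rw [Fin.sum_univ_succAbove _ k]
    have hi : i.castSucc < k ↔ (i : ℕ) < k := Iff.rfl
    simp [Fin.succAbove_lt_iff_castSucc_lt, hi]
  simp only [h, Finset.sum_add_distrib]
  congr 1
  rw [Fin.sum_univ_eq_sum_range (fun i => if i < (k : ℕ) then 1 else 0) n, ← Finset.card_filter]
  have : (Finset.range n).filter (fun i => i < (k : ℕ)) = Finset.range k := by
    ext i
    simp only [Finset.mem_filter, Finset.mem_range]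
    omega
  rw [this, Finset.card_range]

section Algebraic

variable {H : Type u} [NormedAddCommGroup H] [InnerProductSpace ℂ H]

/-! ### Words -/

theorem AlgFock.induction_on {p : AlgFock H → Prop} (v : AlgFock H)
    (word : ∀ (n : ℕ) (η : Fin n → H), p (word η)) (smul : ∀ (c : ℂ) v, p v → p (c • v))
    (add : ∀ v w, p v → p w → p (v + w)) : p v := by
  induction v using DirectSum.induction_on with
  | zero => simpa using smul 0 _ (word 0 Fin.elim0)
  | of n x =>
    induction x using PiTensorProduct.induction_on with
    | smul_tprod c η =>
      have := smul c _ (word n η)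
      rwa [QFock.word, ← map_smul] at this
    | add x y hx hy =>
      rw [map_add]
      exact add _ _ hx hy
  | add v w hv hw => exact add v w hv hw

theorem AlgFock.hom_ext {M : Type*} [AddCommMonoid M] [Module ℂ M] {f g : AlgFock H →ₗ[ℂ] M}
    (h : ∀ (n : ℕ) (η : Fin n → H), f (word η) = g (word η)) : f = g := by
  refine LinearMap.ext fun v => ?_
  induction v using AlgFock.induction_on with
  | word n η => exact h n η
  | smul c v hv => rw [map_smul, map_smul, hv]
  | add v w hv hw => rw [map_add, map_add, hv, hw]

theorem qInner_word_word (q : ℝ) {n : ℕ} (η ξ : Fin n → H) :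
    qInner q (word η) (word ξ) =
      ∑ σ : Equiv.Perm (Fin n), (q : ℂ) ^ inversions σ * ∏ j, ⟪η j, ξ (σ j)⟫_ℂ := by
  rw [qInner, finsum_eq_single _ n]
  · simp [word, qSymm, permute_tprod, tensorInner_tprod, DirectSum.lof_eq_of]
  · intro m hm
    have : word η m = 0 := by
      rw [word, DirectSum.lof_eq_of, DirectSum.of_eq_of_ne _ _ _ hm]
    rw [this]
    simp

theorem qInner_word_word_of_ne (q : ℝ) {n m : ℕ} (hnm : n ≠ m) (η : Fin n → H) (ξ : Fin m → H) :
    qInner q (word η) (word ξ) = 0 := by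
  rw [qInner]
  refine finsum_eq_zero_of_forall_eq_zero fun k => ?_
  by_cases hk : k = n
  · have : word ξ k = 0 := by
      rw [word, DirectSum.lof_eq_of, DirectSum.of_eq_of_ne _ _ _ (by omega)]
    rw [this]
    simp
  · have : word η k = 0 := by
      rw [word, DirectSum.lof_eq_of, DirectSum.of_eq_of_ne _ _ _ hk]
    rw [this]
    simp

/-- Sorting the permutations by the position `k` that they send to `0` expands the sum along the
first letter on the right. This expansion is what makes annihilation the adjoint of creation. -/
theorem qInner_word_cons (q : ℝ) {n : ℕ} (η : Fin (n + 1) → H) (ζ : H) (ξ : Fin n → H) :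
    qInner q (word η) (word (Fin.cons ζ ξ : Fin (n + 1) → H)) =
      ∑ k : Fin (n + 1), (q : ℂ) ^ (k : ℕ) * ⟪η k, ζ⟫_ℂ *
        qInner q (word (k.removeNth η)) (word ξ) := by
  simp only [qInner_word_word]
  rw [← (permInsert_bijective n).sum_comp, Fintype.sum_prod_type]
  refine Finset.sum_congr rfl fun k _ => ?_
  rw [Finset.mul_sum]
  refine Finset.sum_congr rfl fun τ _ => ?_
  rw [Fin.prod_univ_succAbove _ k]
  simp only [permInsert_self, permInsert_succAbove, inversions_permInsert, Fin.cons_zero,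
    Fin.cons_succ, Fin.removeNth]
  ring

end Algebraic

/-! ### Adjoint relations for creation, annihilation and gauge operators -/

section Completed

variable (q : Ioo (-1 : ℝ) 1) {H : Type u} [NormedAddCommGroup H] [InnerProductSpace ℂ H]

theorem denseRange_toFock : DenseRange (toFock q : AlgFock H →ₗ[ℂ] FockSpace q H) :=
  Completion.denseRange_coe (α := PreFock q H)

/-- The annihilation operator is the adjoint of the creation operator. -/
theorem inner_annihilation (ζ : H) (v w : AlgFock H) :
    ⟪toFock q (annihilation (q : ℝ) ζ v), toFock q w⟫_ℂ =
      ⟪toFock q v, toFock q (creation ζ w)⟫_ℂ := by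
  induction v using AlgFock.induction_on with
  | smul c v hv => simp only [map_smul, inner_smul_left, hv]
  | add v v' hv hv' => simp only [map_add, inner_add_left, hv, hv']
  | word n η =>
    induction w using AlgFock.induction_on with
    | smul c v hv => simp only [map_smul, inner_smul_right, hv]
    | add v v' hv hv' => simp only [map_add, inner_add_right, hv, hv']
    | word m ξ =>
      rw [creation_word]
      cases n with
      | zero =>
        rw [annihilation_vacuum, inner_toFock, inner_toFock,
          qInner_word_word_of_ne _ (Nat.succ_ne_zero m).symm]
        rw [← inner_toFock]
        simp
      | succ n =>
        rw [annihilation_word]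
        simp only [map_sum, map_smul, sum_inner, inner_smul_left, inner_toFock]
        by_cases h : n = m
        · subst h
          rw [qInner_word_cons]
          refine Finset.sum_congr rfl fun k _ => ?_
          simp
        · rw [qInner_word_word_of_ne _ (by omega)]
          refine Finset.sum_eq_zero fun k _ => ?_
          rw [qInner_word_word_of_ne _ h, mul_zero]

theorem inner_creation (ζ : H) (v w : AlgFock H) :
    ⟪toFock q (creation ζ v), toFock q w⟫_ℂ =
      ⟪toFock q v, toFock q (annihilation (q : ℝ) ζ w)⟫_ℂ := by
  rw [← inner_conj_symm, ← inner_annihilation, inner_conj_symm]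

/-- The gauge operator of a symmetric operator is symmetric. -/
theorem inner_gauge {T : H →L[ℂ] H} (hT : T.toLinearMap.IsSymmetric) (v w : AlgFock H) :
    ⟪toFock q (gauge (q : ℝ) T v), toFock q w⟫_ℂ =
      ⟪toFock q v, toFock q (gauge (q : ℝ) T w)⟫_ℂ := by
  induction v using AlgFock.induction_on with
  | smul c v hv => simp only [map_smul, inner_smul_left, hv]
  | add v v' hv hv' => simp only [map_add, inner_add_left, hv, hv']
  | word n η =>
    induction w using AlgFock.induction_on with
    | smul c v hv => simp only [map_smul, inner_smul_right, hv]
    | add v v' hv hv' => simp only [map_add, inner_add_right, hv, hv']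
    | word m ξ =>
      cases n with
      | zero =>
        cases m with
        | zero => simp only [gauge_vacuum, map_zero, inner_zero_left, inner_zero_right]
        | succ m =>
          rw [gauge_vacuum, gauge_word]
          simp only [map_sum, map_smul, inner_sum, inner_smul_right, inner_toFock,
            qInner_word_word_of_ne _ (Nat.succ_ne_zero m).symm, mul_zero,
            Finset.sum_const_zero, map_zero, inner_zero_left]
      | succ n =>
        cases m with
        | zero =>
          rw [gauge_vacuum, gauge_word]
          simp only [map_sum, map_smul, sum_inner, inner_smul_left, inner_toFock,
            qInner_word_word_of_ne _ (Nat.succ_ne_zero n), mul_zero,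
            Finset.sum_const_zero, map_zero, inner_zero_right]
        | succ m =>
          -- Each term of the gauge operator is a creation. Moving it across the inner product turns
          -- both sides into the same double sum, with weights `q^k q^l` symmetric in the two
          -- positions.
          simp only [gauge_word, ← creation_word, map_sum, map_smul, sum_inner, inner_sum,
            inner_smul_left, inner_smul_right, inner_creation, annihilation_word,
            ← inner_annihilation, Finset.mul_sum]
          rw [Finset.sum_comm]
          refine Finset.sum_congr rfl fun k _ => Finset.sum_congr rfl fun l _ => ?_
          have h : ⟪T (η l), ξ k⟫_ℂ = ⟪η l, T (ξ k)⟫_ℂ := hT (η l) (ξ k)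
          simp only [map_mul, map_pow, Complex.conj_ofReal, inner_conj_symm, h]
          ring

end Completed

end QFock

/-! ### Boundedness of symmetric operators with controlled powers -/

/-- A log-convex sequence of nonnegative numbers that is `O(M ^ m)` satisfies `x 1 ≤ M * x 0`. -/
theorem le_mul_of_sq_le_mul {x : ℕ → ℝ} {M C : ℝ} (hx : ∀ m, 0 ≤ x m) (hM : 0 ≤ M)
    (hlog : ∀ m, x (m + 1) ^ 2 ≤ x m * x (m + 2)) (hC : ∀ m, x m ≤ C * M ^ m) :
    x 1 ≤ M * x 0 := by
  by_contra! h
  have h1 : 0 < x 1 := (mul_nonneg hM (hx 0)).trans_lt h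
  have h0 : 0 < x 0 := by
    refine (hx 0).lt_of_ne fun h0 => ?_
    have := hlog 0
    rw [← h0, zero_mul] at this
    exact absurd this (not_le.2 (pow_pos h1 2))
  -- Log-convexity makes the successive ratios nondecreasing, so an initial ratio above `M` forces
  -- growth at least like `ρ ^ m`, which beats `C * M ^ m`.
  set ρ := x 1 / x 0 with hρ
  have hMρ : M < ρ := by rwa [hρ, lt_div_iff₀ h0]
  have hρ0 : 0 < ρ := div_pos h1 h0
  have hstep : ∀ m, 0 < x m ∧ ρ * x m ≤ x (m + 1) := by
    intro m
    induction m with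
    | zero => exact ⟨h0, by rw [hρ, div_mul_cancel₀ _ h0.ne']⟩
    | succ m ih =>
      have hpos : 0 < x (m + 1) := (mul_pos hρ0 ih.1).trans_le ih.2
      refine ⟨hpos, ?_⟩
      have := hlog m
      refine le_of_mul_le_mul_left ?_ ih.1
      calc x m * (ρ * x (m + 1)) = ρ * x m * x (m + 1) := by ring
        _ ≤ x (m + 1) * x (m + 1) := mul_le_mul_of_nonneg_right ih.2 hpos.le
        _ ≤ x m * x (m + 1 + 1) := by rw [← sq]; exact this
  have hgeo : ∀ m, ρ ^ m * x 0 ≤ x m := by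
    intro m
    induction m with
    | zero => simp
    | succ m ih =>
      calc ρ ^ (m + 1) * x 0 = ρ * (ρ ^ m * x 0) := by ring
        _ ≤ ρ * x m := mul_le_mul_of_nonneg_left ih hρ0.le
        _ ≤ x (m + 1) := (hstep m).2
  -- For `M = 0` the quotient `ρ / M` is useless, but the bound at `m = 1` already gives `x 1 ≤ 0`.
  rcases hM.eq_or_lt with rfl | hM
  · have := hC 1
    rw [pow_one, mul_zero] at this
    exact absurd this (not_le.2 h1)
  · obtain ⟨m, hm⟩ := pow_unbounded_of_one_lt (C / x 0) ((one_lt_div hM).2 hMρ)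
    rw [div_pow, div_lt_div_iff₀ h0 (pow_pos hM m)] at hm
    exact absurd ((hgeo m).trans (hC m)) (not_le.2 hm)

/-- An operator that is symmetric for a semi-inner product and whose powers grow at most like
`M ^ m` on each vector is bounded by `M`. -/
theorem norm_apply_le_of_pow_le {V E : Type*} [AddCommGroup V] [Module ℂ V]
    [NormedAddCommGroup E] [InnerProductSpace ℂ E] (j : V →ₗ[ℂ] E) (A : V →ₗ[ℂ] V)
    (hA : ∀ v w, ⟪j (A v), j w⟫_ℂ = ⟪j v, j (A w)⟫_ℂ) {M : ℝ} (hM : 0 ≤ M) (v : V)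
    (hv : ∃ C, ∀ m : ℕ, ‖j ((A ^ m) v)‖ ≤ C * M ^ m) : ‖j (A v)‖ ≤ M * ‖j v‖ := by
  obtain ⟨C, hC⟩ := hv
  have := le_mul_of_sq_le_mul (x := fun m => ‖j ((A ^ m) v)‖) (fun m => norm_nonneg _) hM
    (fun m => ?_) hC
  · simpa using this
  -- Log-convexity: symmetry moves one factor `A` to the other side, then Cauchy–Schwarz applies.
  · have e : ⟪j ((A ^ (m + 1)) v), j ((A ^ (m + 1)) v)⟫_ℂ =
        ⟪j ((A ^ m) v), j ((A ^ (m + 2)) v)⟫_ℂ := by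
      have h1 : (A ^ (m + 1)) v = A ((A ^ m) v) := by rw [pow_succ', Module.End.mul_apply]
      have h2 : (A ^ (m + 2)) v = A ((A ^ (m + 1)) v) := by rw [pow_succ', Module.End.mul_apply]
      rw [h2, ← hA, h1]
    rw [← inner_self_eq_norm_sq (𝕜 := ℂ), e]
    exact (RCLike.re_le_norm _).trans (norm_inner_le_norm _ _)

/-! ### Norm estimates on words and boundedness of the field operators -/

namespace QFock

universe u

theorem prod_norm_removeNth {H : Type*} [NormedAddCommGroup H] {n : ℕ} (η : Fin (n + 1) → H)
    (k : Fin (n + 1)) :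
    ‖η k‖ * ∏ i, ‖k.removeNth η i‖ = ∏ i, ‖η i‖ :=
  (Fin.prod_univ_succAbove (fun i => ‖η i‖) k).symm

theorem prod_norm_cons {H : Type*} [NormedAddCommGroup H] {n : ℕ} (ζ : H) (η : Fin n → H) :
    ∏ i, ‖(Fin.cons ζ η : Fin (n + 1) → H) i‖ = ‖ζ‖ * ∏ i, ‖η i‖ := by
  simp [Fin.prod_univ_succ]

section Completed

variable (q : Ioo (-1 : ℝ) 1) {H : Type u} [NormedAddCommGroup H] [InnerProductSpace ℂ H]

/-- The constant `1 / (1 - |q|)`. -/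
def geomConst : ℝ := (1 - |(q : ℝ)|)⁻¹

theorem abs_q_lt_one : |(q : ℝ)| < 1 := abs_lt.2 q.2

theorem one_le_geomConst : 1 ≤ geomConst q :=
  (one_le_inv₀ (sub_pos.2 (abs_q_lt_one q))).2 (sub_le_self _ (abs_nonneg _))

theorem geomConst_nonneg : 0 ≤ geomConst q := zero_le_one.trans (one_le_geomConst q)

theorem sum_abs_pow_le (n : ℕ) : ∑ k : Fin n, |(q : ℝ)| ^ (k : ℕ) ≤ geomConst q := by
  rw [Fin.sum_univ_eq_sum_range (fun k => |(q : ℝ)| ^ k) n, geomConst,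
    ← tsum_geometric_of_lt_one (abs_nonneg _) (abs_q_lt_one q)]
  exact (summable_geometric_of_lt_one (abs_nonneg _) (abs_q_lt_one q)).sum_le_tsum _
    fun k _ => pow_nonneg (abs_nonneg _) k

/-- A `q`-weighted sum of vectors of norm at most `B` has norm at most `B / (1 - |q|)`. -/
theorem norm_sum_pow_smul_le {E : Type*} [SeminormedAddCommGroup E] [NormedSpace ℂ E] {n : ℕ}
    {x : Fin n → E} {B : ℝ} (hB : 0 ≤ B) (hx : ∀ k, ‖x k‖ ≤ B) :
    ‖∑ k : Fin n, ((q : ℝ) : ℂ) ^ (k : ℕ) • x k‖ ≤ geomConst q * B := by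
  calc ‖∑ k : Fin n, ((q : ℝ) : ℂ) ^ (k : ℕ) • x k‖
      ≤ ∑ k : Fin n, |(q : ℝ)| ^ (k : ℕ) * B := by
        refine norm_sum_le_of_le _ fun k _ => ?_
        rw [norm_smul, norm_pow, Complex.norm_real, Real.norm_eq_abs]
        exact mul_le_mul_of_nonneg_left (hx k) (pow_nonneg (abs_nonneg _) _)
    _ = (∑ k : Fin n, |(q : ℝ)| ^ (k : ℕ)) * B := by rw [Finset.sum_mul]
    _ ≤ geomConst q * B := mul_le_mul_of_nonneg_right (sum_abs_pow_le q n) hB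

/-- A crude bound that suffices because only exponential growth in `n` matters. The first letter of
one copy of the word is moved across as an annihilation, whose `q`-weights sum to at most `1 / (1 -
|q|)`; the shorter words are covered by induction. -/
theorem norm_word_le {n : ℕ} (η : Fin n → H) :
    ‖toFock q (word η)‖ ≤ geomConst q ^ n * ∏ i, ‖η i‖ := by
  have hK := one_le_geomConst q
  induction n with
  | zero =>
    have h := inner_toFock q (word η) (word η)
    rw [qInner_word_word] at h
    have h2 : ‖toFock q (word η)‖ ^ 2 = 1 := by
      rw [← inner_self_eq_norm_sq (𝕜 := ℂ), h]
      simp [inversions]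
    simpa using ((pow_eq_one_iff_of_nonneg (norm_nonneg _) two_ne_zero).1 h2).le
  | succ n ih =>
    have hp : 0 ≤ ∏ i, ‖η i‖ := Finset.prod_nonneg fun i _ => norm_nonneg _
    refine abs_le_of_sq_le_sq' ?_ (mul_nonneg (pow_nonneg (geomConst_nonneg q) _) hp) |>.2
    have hη : η = Fin.cons (η 0) (Fin.tail η) := (Fin.cons_self_tail η).symm
    have hw : word η = creation (η 0) (word (Fin.tail η)) := by
      rw [creation_word, ← hη]
    have hprod : ‖η 0‖ * ∏ i, ‖Fin.tail η i‖ = ∏ i, ‖η i‖ :=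
      (Fin.prod_univ_succ fun i => ‖η i‖).symm
    have h1 : ‖toFock q (annihilation (q : ℝ) (η 0) (word η))‖ ≤
        geomConst q * (‖η 0‖ * (geomConst q ^ n * ∏ i, ‖η i‖)) := by
      rw [annihilation_word]
      simp only [map_sum, map_smul, mul_smul]
      refine norm_sum_pow_smul_le q (by positivity) fun k => ?_
      rw [norm_smul]
      calc ‖⟪η 0, η k⟫_ℂ‖ * ‖toFock q (word (k.removeNth η))‖
          ≤ ‖η 0‖ * ‖η k‖ * (geomConst q ^ n * ∏ i, ‖k.removeNth η i‖) :=
            mul_le_mul (norm_inner_le_norm _ _) (ih _) (norm_nonneg _) (by positivity)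
        _ = ‖η 0‖ * (geomConst q ^ n * ∏ i, ‖η i‖) := by
            rw [← prod_norm_removeNth η k]; ring
    calc ‖toFock q (word η)‖ ^ 2
        = ‖⟪toFock q (word (Fin.tail η)), toFock q (annihilation (q : ℝ) (η 0) (word η))⟫_ℂ‖ := by
          rw [← inner_creation, ← hw, inner_self_eq_norm_sq_to_K]
          simp
      _ ≤ geomConst q ^ n * (∏ i, ‖Fin.tail η i‖) *
            (geomConst q * (‖η 0‖ * (geomConst q ^ n * ∏ i, ‖η i‖))) :=
          (norm_inner_le_norm _ _).trans
            (mul_le_mul (ih _) h1 (norm_nonneg _) (by positivity))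
      _ = geomConst q ^ (2 * n + 1) * (∏ i, ‖η i‖) ^ 2 := by rw [← hprod]; ring
      -- The odd exponent is rounded up, using that the constant is at least `1`, so that the bound
      -- becomes a square.
      _ ≤ geomConst q ^ (2 * n + 2) * (∏ i, ‖η i‖) ^ 2 :=
          mul_le_mul_of_nonneg_right (pow_le_pow_right₀ hK (by omega)) (by positivity)
      _ = (geomConst q ^ (n + 1) * ∏ i, ‖η i‖) ^ 2 := by ring

/-- The operator `a(ζ) + a*(ζ) + p(T)` on the algebraic Fock space. -/
def algField (ζ : H) (T : H →L[ℂ] H) : AlgFock H →ₗ[ℂ] AlgFock H :=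
  annihilation (q : ℝ) ζ + creation ζ + gauge (q : ℝ) T

theorem algField_apply (ζ : H) (T : H →L[ℂ] H) (v : AlgFock H) :
    algField q ζ T v = annihilation (q : ℝ) ζ v + creation ζ v + gauge (q : ℝ) T v := rfl

theorem inner_algField (ζ : H) {T : H →L[ℂ] H} (hT : T.toLinearMap.IsSymmetric)
    (v w : AlgFock H) :
    ⟪toFock q (algField q ζ T v), toFock q w⟫_ℂ = ⟪toFock q v, toFock q (algField q ζ T w)⟫_ℂ := by
  simp only [algField_apply, map_add, inner_add_left, inner_add_right, inner_annihilation,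
    inner_creation, inner_gauge q hT]
  ring

/-- The bound for the operator `a(ζ) + a*(ζ) + p(T)`. -/
def fieldBound (ζ : H) (T : H →L[ℂ] H) : ℝ :=
  geomConst q * ‖ζ‖ + geomConst q * ‖ζ‖ + geomConst q * ‖T‖

theorem fieldBound_nonneg (ζ : H) (T : H →L[ℂ] H) : 0 ≤ fieldBound q ζ T := by
  have := geomConst_nonneg q
  unfold fieldBound
  positivity

/-- The weight `K ^ n * ∏ ‖η i‖` is chosen so that each of the three parts of the operator
multiplies it by a bounded factor: creation adds a letter and costs `K * ‖ζ‖`, while annihilation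
and gauge pay `K` for the geometric sum of `q`-powers. -/
theorem norm_algField_pow_word_le (ζ : H) (T : H →L[ℂ] H) (m : ℕ) {n : ℕ} (η : Fin n → H) :
    ‖toFock q ((algField q ζ T ^ m) (word η))‖ ≤
      fieldBound q ζ T ^ m * (geomConst q ^ n * ∏ i, ‖η i‖) := by
  induction m generalizing n with
  | zero => simpa using norm_word_le q η
  | succ m ih =>
    have hK := one_le_geomConst q
    have hK0 := geomConst_nonneg q
    have hM := fieldBound_nonneg q ζ T
    set K := geomConst q
    set M := fieldBound q ζ T with hMdef
    have hp : 0 ≤ ∏ i, ‖η i‖ := Finset.prod_nonneg fun i _ => norm_nonneg _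
    -- The innermost factor is split off: its value on a word is a combination of words, of length
    -- `n - 1`, `n` or `n + 1`, to which the induction hypothesis applies.
    rw [pow_succ, Module.End.mul_apply, algField_apply, map_add, map_add, map_add, map_add]
    have hc : ‖toFock q ((algField q ζ T ^ m) (creation ζ (word η)))‖ ≤
        K * ‖ζ‖ * (M ^ m * (K ^ n * ∏ i, ‖η i‖)) := by
      rw [creation_word]
      refine (ih _).trans_eq ?_
      rw [prod_norm_cons]
      ring
    have ha : ‖toFock q ((algField q ζ T ^ m) (annihilation (q : ℝ) ζ (word η)))‖ ≤
        K * ‖ζ‖ * (M ^ m * (K ^ n * ∏ i, ‖η i‖)) := by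
      cases n with
      | zero =>
        rw [annihilation_vacuum, map_zero, map_zero, norm_zero]
        positivity
      | succ n =>
        rw [annihilation_word]
        simp only [map_sum, map_smul, mul_smul]
        have : K * ‖ζ‖ * (M ^ m * (K ^ (n + 1) * ∏ i, ‖η i‖)) =
          K * (‖ζ‖ * (M ^ m * (K ^ (n + 1) * ∏ i, ‖η i‖))) := by ring
        rw [this]
        refine norm_sum_pow_smul_le q (by positivity) fun k => ?_
        rw [norm_smul]
        calc ‖⟪ζ, η k⟫_ℂ‖ * ‖toFock q ((algField q ζ T ^ m) (word (k.removeNth η)))‖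
            ≤ ‖ζ‖ * ‖η k‖ * (M ^ m * (K ^ n * ∏ i, ‖k.removeNth η i‖)) :=
              mul_le_mul (norm_inner_le_norm _ _) (ih _) (norm_nonneg _) (by positivity)
          _ = ‖ζ‖ * (M ^ m * (K ^ n * ∏ i, ‖η i‖)) := by
              rw [← prod_norm_removeNth η k]; ring
          -- Removing a letter saves a factor `K ≥ 1`, which is given away.
          _ ≤ ‖ζ‖ * (M ^ m * (K ^ (n + 1) * ∏ i, ‖η i‖)) := by
              gcongr ‖ζ‖ * (M ^ m * (?_ * _))
              exact pow_le_pow_right₀ hK (by omega)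
    have hg : ‖toFock q ((algField q ζ T ^ m) (gauge (q : ℝ) T (word η)))‖ ≤
        K * ‖T‖ * (M ^ m * (K ^ n * ∏ i, ‖η i‖)) := by
      cases n with
      | zero =>
        rw [gauge_vacuum, map_zero, map_zero, norm_zero]
        positivity
      | succ n =>
        rw [gauge_word]
        simp only [map_sum, map_smul]
        have : K * ‖T‖ * (M ^ m * (K ^ (n + 1) * ∏ i, ‖η i‖)) =
          K * (‖T‖ * (M ^ m * (K ^ (n + 1) * ∏ i, ‖η i‖))) := by ring
        rw [this]
        refine norm_sum_pow_smul_le q (by positivity) fun k => ?_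
        refine (ih _).trans ?_
        rw [prod_norm_cons]
        calc M ^ m * (K ^ (n + 1) * (‖T (η k)‖ * ∏ i, ‖k.removeNth η i‖))
            ≤ M ^ m * (K ^ (n + 1) * (‖T‖ * ‖η k‖ * ∏ i, ‖k.removeNth η i‖)) := by
              have := T.le_opNorm (η k)
              have h0 : 0 ≤ ∏ i, ‖k.removeNth η i‖ := Finset.prod_nonneg fun i _ => norm_nonneg _
              gcongr
          _ = ‖T‖ * (M ^ m * (K ^ (n + 1) * ∏ i, ‖η i‖)) := by
              rw [← prod_norm_removeNth η k]; ring
    refine (norm_add₃_le.trans (add_le_add_three ha hc hg)).trans_eq ?_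
    rw [hMdef, fieldBound]
    ring

/-- The prefactor in the growth of `‖A^m v‖` depends on `v`, but the rate does not; for a symmetric
operator the rate alone bounds the norm. -/
theorem norm_algField_le (ζ : H) {T : H →L[ℂ] H} (hT : T.toLinearMap.IsSymmetric)
    (v : AlgFock H) : ‖toFock q (algField q ζ T v)‖ ≤ fieldBound q ζ T * ‖toFock q v‖ := by
  refine norm_apply_le_of_pow_le (toFock q) (algField q ζ T) (inner_algField q ζ hT)
    (fieldBound_nonneg q ζ T) v ?_
  induction v using AlgFock.induction_on with
  | word n η =>
    exact ⟨geomConst q ^ n * ∏ i, ‖η i‖, fun m =>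
      (norm_algField_pow_word_le q ζ T m η).trans_eq (mul_comm _ _)⟩
  | smul c v hv =>
    obtain ⟨C, hC⟩ := hv
    refine ⟨‖c‖ * C, fun m => ?_⟩
    rw [map_smul, map_smul, norm_smul, mul_assoc]
    exact mul_le_mul_of_nonneg_left (hC m) (norm_nonneg c)
  | add v w hv hw =>
    obtain ⟨C, hC⟩ := hv
    obtain ⟨D, hD⟩ := hw
    refine ⟨C + D, fun m => ?_⟩
    rw [map_add, map_add, add_mul]
    exact norm_add_le_of_le (hC m) (hD m)

/-- The extension by `extendOfNorm` agrees with the algebraic operator only once a norm bound is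
known; this is where boundedness enters. -/
theorem fieldOperator_toFock (ζ : H) {T : H →L[ℂ] H} (hT : T.toLinearMap.IsSymmetric)
    (v : AlgFock H) : fieldOperator q ζ T (toFock q v) = toFock q (algField q ζ T v) := by
  exact LinearMap.extendOfNorm_eq (f := toFock q ∘ₗ algField q ζ T) (e := toFock q)
    (denseRange_toFock q) ⟨_, norm_algField_le q ζ hT⟩ v

/-- Bounded operators on the `q`-Fock space are determined by their values on words. -/
theorem fockOperator_ext {A B : FockSpace q H →L[ℂ] FockSpace q H}
    (h : ∀ (n : ℕ) (η : Fin n → H), A (toFock q (word η)) = B (toFock q (word η))) : A = B := by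
  have e : A.toLinearMap ∘ₗ toFock q = B.toLinearMap ∘ₗ toFock q := AlgFock.hom_ext h
  refine ContinuousLinearMap.ext fun x => ?_
  induction x using (denseRange_toFock q (H := H)).induction_on with
  | hp => exact isClosed_eq A.continuous B.continuous
  | ih v => exact LinearMap.congr_fun e v

theorem isSymmetric_of_inner_toFock {A : FockSpace q H →L[ℂ] FockSpace q H}
    (h : ∀ v w, ⟪A (toFock q v), toFock q w⟫_ℂ = ⟪toFock q v, A (toFock q w)⟫_ℂ) :
    star A = A := by
  rw [ContinuousLinearMap.star_eq_adjoint]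
  refine ((ContinuousLinearMap.eq_adjoint_iff A A).2 fun x y => ?_).symm
  induction x, y using (denseRange_toFock q).induction_on₂ with
  | hp => exact isClosed_eq (by fun_prop) (by fun_prop)
  | h v w => exact h v w

theorem star_fieldOperator (ζ : H) {T : H →L[ℂ] H} (hT : T.toLinearMap.IsSymmetric) :
    star (fieldOperator q ζ T) = fieldOperator q ζ T := by
  refine isSymmetric_of_inner_toFock q fun v w => ?_
  rw [fieldOperator_toFock q ζ hT, fieldOperator_toFock q ζ hT, inner_algField q ζ hT]

end Completed

end QFock

/-! ### The `q`-commutation relation and elementary identities on words -/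

namespace QFock

universe u

theorem removeNth_castSucc_snoc {α : Type*} {n : ℕ} (η : Fin (n + 1) → α) (ξ : α) (k : Fin (n + 1)) :
    k.castSucc.removeNth (Fin.snoc η ξ : Fin (n + 2) → α) =
      (Fin.snoc (k.removeNth η) ξ : Fin (n + 1) → α) := by
  ext i
  refine Fin.lastCases ?_ (fun i => ?_) i <;> simp [Fin.removeNth]

theorem inversions_fin_zero (σ : Equiv.Perm (Fin 0)) : inversions σ = 0 := by
  simp [inversions_eq_sum]

theorem inversions_fin_one (σ : Equiv.Perm (Fin 1)) : inversions σ = 0 := by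
  simp [inversions_eq_sum]

section Algebraic

variable {H : Type u} [NormedAddCommGroup H] [InnerProductSpace ℂ H]

theorem word_eq_zero {n : ℕ} {η : Fin n → H} (i : Fin n) (h : η i = 0) : word η = 0 := by
  rw [word, (PiTensorProduct.tprod ℂ).map_coord_zero i h, map_zero]

theorem word_cons_sub (x y : H) {n : ℕ} (η : Fin n → H) :
    word (Fin.cons (x - y) η : Fin (n + 1) → H) =
      word (Fin.cons x η : Fin (n + 1) → H) - word (Fin.cons y η : Fin (n + 1) → H) := by
  have h := LinearMap.map_sub
    (PiTensorProduct.tprod ℂ : MultilinearMap ℂ (fun _ : Fin (n + 1) => H) _).curryLeft x y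
  have h2 := congrArg (fun f => f η) h
  simp only [MultilinearMap.curryLeft_apply, sub_apply] at h2
  simp only [word, h2, map_sub]

theorem creation_zero (v : AlgFock H) : creation 0 v = 0 := by
  induction v using AlgFock.induction_on with
  | word n η => exact (creation_word 0 η).trans (word_eq_zero 0 rfl)
  | smul c v hv => rw [map_smul, hv, smul_zero]
  | add v w hv hw => rw [map_add, hv, hw, add_zero]

theorem annihilation_zero (q : ℝ) (v : AlgFock H) : annihilation q 0 v = 0 := by
  induction v using AlgFock.induction_on with
  | word n η =>
    cases n with
    | zero => exact annihilation_vacuum q 0 η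
    | succ n => simp [annihilation_word]
  | smul c v hv => rw [map_smul, hv, smul_zero]
  | add v w hv hw => rw [map_add, hv, hw, add_zero]

/-- The `q`-commutation relation `a(ζ) a*(ξ) = ⟨ζ, ξ⟩ + q a*(ξ) a(ζ)`. -/
theorem annihilation_creation (q : ℝ) (ζ ξ : H) (v : AlgFock H) :
    annihilation q ζ (creation ξ v) =
      ⟪ζ, ξ⟫_ℂ • v + (q : ℂ) • creation ξ (annihilation q ζ v) := by
  induction v using AlgFock.induction_on with
  | smul c v hv =>
    simp only [map_smul, hv, smul_add, smul_comm c]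
  | add v w hv hw =>
    simp only [map_add, hv, hw, smul_add]
    abel
  | word n η =>
    rw [creation_word, annihilation_word, Fin.sum_univ_succ]
    have h0 : (0 : Fin (n + 1)).removeNth (Fin.cons ξ η : Fin (n + 1) → H) = η := by
      ext i
      simp [Fin.removeNth]
    rw [h0]
    simp only [Fin.val_zero, pow_zero, one_mul, Fin.cons_zero, Fin.cons_succ, Fin.val_succ]
    congr 1
    cases n with
    | zero => simp [annihilation_vacuum]
    | succ n =>
      rw [annihilation_word, map_sum, Finset.smul_sum]
      refine Finset.sum_congr rfl fun k _ => ?_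
      have hk : k.succ.removeNth (Fin.cons ξ η : Fin (n + 2) → H) =
          Fin.cons ξ (k.removeNth η) := by
        ext i
        refine Fin.cases ?_ (fun i => ?_) i <;> simp [Fin.removeNth]
      rw [hk, map_smul, creation_word, smul_smul, pow_succ']
      ring_nf

/-! ### Second quantization -/

/-- `η₁ ⊗ ⋯ ⊗ ηₙ ↦ P η₁ ⊗ ⋯ ⊗ P ηₙ`. -/
def secondQuant (P : H →L[ℂ] H) : AlgFock H →ₗ[ℂ] AlgFock H :=
  DirectSum.toModule ℂ ℕ _ fun n =>
    DirectSum.lof ℂ ℕ (fun n => ⨂[ℂ]^n H) n ∘ₗ PiTensorProduct.map fun _ => P.toLinearMap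

theorem secondQuant_word (P : H →L[ℂ] H) {n : ℕ} (η : Fin n → H) :
    secondQuant P (word η) = word fun i => P (η i) := by
  simp [secondQuant, word]

theorem secondQuant_secondQuant {P : H →L[ℂ] H} (hP : ∀ x, P (P x) = P x) (v : AlgFock H) :
    secondQuant P (secondQuant P v) = secondQuant P v := by
  induction v using AlgFock.induction_on with
  | word n η => simp only [secondQuant_word, hP]
  | smul c v hv => simp only [map_smul, hv]
  | add v w hv hw => simp only [map_add, hv, hw]

theorem secondQuant_creation (P : H →L[ℂ] H) (ζ : H) (v : AlgFock H) :
    secondQuant P (creation ζ v) = creation (P ζ) (secondQuant P v) := by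
  induction v using AlgFock.induction_on with
  | word n η =>
    rw [creation_word, secondQuant_word, secondQuant_word, creation_word]
    congr 1
    ext i
    refine Fin.cases ?_ (fun i => ?_) i <;> simp
  | smul c v hv => simp only [map_smul, hv]
  | add v w hv hw => simp only [map_add, hv, hw]

theorem annihilation_secondQuant (q : ℝ) {P : H →L[ℂ] H} (hP : P.toLinearMap.IsSymmetric) (ζ : H)
    (v : AlgFock H) :
    annihilation q ζ (secondQuant P v) = secondQuant P (annihilation q (P ζ) v) := by
  induction v using AlgFock.induction_on with
  | word n η =>
    rw [secondQuant_word]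
    cases n with
    | zero => rw [annihilation_vacuum, annihilation_vacuum, map_zero]
    | succ n =>
      rw [annihilation_word, annihilation_word, map_sum]
      refine Finset.sum_congr rfl fun k _ => ?_
      have h : ⟪P ζ, η k⟫_ℂ = ⟪ζ, P (η k)⟫_ℂ := hP ζ (η k)
      rw [map_smul, secondQuant_word, h]
      rfl
  | smul c v hv => simp only [map_smul, hv]
  | add v w hv hw => simp only [map_add, hv, hw]

theorem gauge_secondQuant (q : ℝ) {P T : H →L[ℂ] H} (h : ∀ x, P (T x) = T (P x))
    (v : AlgFock H) :
    gauge q T (secondQuant P v) = secondQuant P (gauge q T v) := by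
  induction v using AlgFock.induction_on with
  | word n η =>
    rw [secondQuant_word]
    cases n with
    | zero => rw [gauge_vacuum, gauge_vacuum, map_zero]
    | succ n =>
      rw [gauge_word, gauge_word, map_sum]
      refine Finset.sum_congr rfl fun k _ => ?_
      rw [map_smul, ← creation_word, ← creation_word, secondQuant_creation, secondQuant_word, h]
      rfl
  | smul c v hv => simp only [map_smul, hv]
  | add v w hv hw => simp only [map_add, hv, hw]

theorem gauge_secondQuant_eq_zero (q : ℝ) {P T : H →L[ℂ] H} (h : ∀ x, T (P x) = 0)
    (v : AlgFock H) : gauge q T (secondQuant P v) = 0 := by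
  induction v using AlgFock.induction_on with
  | word n η =>
    rw [secondQuant_word]
    cases n with
    | zero => exact gauge_vacuum q T _
    | succ n =>
      rw [gauge_word]
      refine Finset.sum_eq_zero fun k _ => ?_
      rw [h, ← creation_word, creation_zero, smul_zero]
  | smul c v hv => rw [map_smul, map_smul, hv, smul_zero]
  | add v w hv hw => rw [map_add, map_add, hv, hw, add_zero]

/-! ### Right creation -/

/-- `η₁ ⊗ ⋯ ⊗ ηₙ ↦ η₁ ⊗ ⋯ ⊗ ηₙ ⊗ ξ`. -/
def rightCreation (ξ : H) : AlgFock H →ₗ[ℂ] AlgFock H :=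
  DirectSum.toModule ℂ ℕ _ fun n =>
    DirectSum.lof ℂ ℕ (fun n => ⨂[ℂ]^n H) (n + 1) ∘ₗ
      PiTensorProduct.lift ((LinearMap.applyₗ ξ).compMultilinearMap
        (PiTensorProduct.tprod ℂ : MultilinearMap ℂ (fun _ : Fin (n + 1) => H) _).curryRight)

theorem rightCreation_word (ξ : H) {n : ℕ} (η : Fin n → H) :
    rightCreation ξ (word η) = word (Fin.snoc η ξ : Fin (n + 1) → H) := by
  simp [rightCreation, word]

theorem rightCreation_creation (ξ ζ : H) (v : AlgFock H) :
    rightCreation ξ (creation ζ v) = creation ζ (rightCreation ξ v) := by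
  induction v using AlgFock.induction_on with
  | word n η =>
    rw [creation_word, rightCreation_word, rightCreation_word, creation_word,
      Fin.cons_snoc_eq_snoc_cons]
  | smul c v hv => simp only [map_smul, hv]
  | add v w hv hw => simp only [map_add, hv, hw]

/-- A letter appended on the right leaves the positions, hence the `q`-weights, of the others
unchanged. It contributes only the last term of the sum, whose coefficient `⟨ζ, ξ⟩` vanishes. -/
theorem annihilation_rightCreation (q : ℝ) {ζ ξ : H} (h : ⟪ζ, ξ⟫_ℂ = 0) (v : AlgFock H) :
    annihilation q ζ (rightCreation ξ v) = rightCreation ξ (annihilation q ζ v) := by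
  induction v using AlgFock.induction_on with
  | word n η =>
    rw [rightCreation_word, annihilation_word, Fin.sum_univ_castSucc]
    simp only [Fin.snoc_last, h, mul_zero, zero_smul, add_zero, Fin.snoc_castSucc, Fin.val_castSucc]
    cases n with
    | zero => simp [annihilation_vacuum]
    | succ n =>
      rw [annihilation_word, map_sum]
      refine Finset.sum_congr rfl fun k _ => ?_
      rw [removeNth_castSucc_snoc, map_smul, rightCreation_word]
  | smul c v hv => simp only [map_smul, hv]
  | add v w hv hw => simp only [map_add, hv, hw]

theorem gauge_rightCreation (q : ℝ) {T : H →L[ℂ] H} {ξ : H} (h : T ξ = 0) (v : AlgFock H) :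
    gauge q T (rightCreation ξ v) = rightCreation ξ (gauge q T v) := by
  induction v using AlgFock.induction_on with
  | word n η =>
    rw [rightCreation_word, gauge_word, Fin.sum_univ_castSucc]
    simp only [Fin.snoc_last, h, Fin.snoc_castSucc, Fin.val_castSucc, ← creation_word,
      creation_zero, smul_zero, add_zero]
    cases n with
    | zero => simp [gauge_vacuum]
    | succ n =>
      rw [gauge_word, map_sum]
      refine Finset.sum_congr rfl fun k _ => ?_
      rw [removeNth_castSucc_snoc, map_smul, ← creation_word, rightCreation_creation,
        rightCreation_word]
  | smul c v hv => simp only [map_smul, hv]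
  | add v w hv hw => simp only [map_add, hv, hw]

end Algebraic

/-! ### Field operators against second-quantized projections -/

section Completed

variable (q : Ioo (-1 : ℝ) 1) {H : Type u} [NormedAddCommGroup H] [InnerProductSpace ℂ H]

theorem secondQuant_algField {P T : H →L[ℂ] H} {ζ : H} (hP : P.toLinearMap.IsSymmetric)
    (hζ : P ζ = ζ) (hT : ∀ x, P (T x) = T (P x)) (v : AlgFock H) :
    secondQuant P (algField q ζ T v) = algField q ζ T (secondQuant P v) := by
  simp only [algField_apply, map_add, secondQuant_creation, annihilation_secondQuant _ hP,
    gauge_secondQuant _ hT, hζ]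

theorem rightCreation_algField {T : H →L[ℂ] H} {ζ ξ : H} (hζ : ⟪ζ, ξ⟫_ℂ = 0) (hT : T ξ = 0)
    (v : AlgFock H) :
    rightCreation ξ (algField q ζ T v) = algField q ζ T (rightCreation ξ v) := by
  simp only [algField_apply, map_add, rightCreation_creation, annihilation_rightCreation _ hζ,
    gauge_rightCreation _ hT]

/-- On vectors over the range of `P`, a field living on the complement can neither annihilate a
letter nor act on one by its gauge part. -/
theorem algField_secondQuant {P S : H →L[ℂ] H} {ξ : H} (hP : P.toLinearMap.IsSymmetric)
    (hξ : P ξ = 0) (hS : ∀ x, S (P x) = 0) (v : AlgFock H) :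
    algField q ξ S (secondQuant P v) = creation ξ (secondQuant P v) := by
  rw [algField_apply, annihilation_secondQuant _ hP, hξ, annihilation_zero, map_zero,
    gauge_secondQuant_eq_zero _ hS, zero_add, add_zero]

/-- The inner field only creates `ξ`. In the result, every term that keeps the letter `ξ` is killed
by the outer projection since `P ξ = 0`; only the scalar from the `q`-commutation relation survives.
The vector `ζ` is unrestricted, so its interval may straddle the cut. -/
theorem secondQuant_algField_algField {P T S : H →L[ℂ] H} {ζ ξ : H}
    (hP : P.toLinearMap.IsSymmetric) (hP2 : ∀ x, P (P x) = P x) (hT : ∀ x, P (T x) = T (P x))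
    (hξ : P ξ = 0) (hS : ∀ x, S (P x) = 0) (v : AlgFock H) :
    secondQuant P (algField q ζ T (algField q ξ S (secondQuant P v))) =
      ⟪ζ, ξ⟫_ℂ • secondQuant P v := by
  rw [algField_secondQuant q hP hξ hS, algField_apply, annihilation_creation]
  simp only [map_add, map_smul, secondQuant_creation, hξ, creation_zero, smul_zero, add_zero,
    ← gauge_secondQuant _ hT, map_zero, secondQuant_secondQuant hP2]

theorem inner_secondQuant {P : H →L[ℂ] H} (hP : P.toLinearMap.IsSymmetric) (v w : AlgFock H) :
    ⟪toFock q (secondQuant P v), toFock q w⟫_ℂ = ⟪toFock q v, toFock q (secondQuant P w)⟫_ℂ := by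
  induction v using AlgFock.induction_on with
  | smul c v hv => simp only [map_smul, inner_smul_left, hv]
  | add v v' hv hv' => simp only [map_add, inner_add_left, hv, hv']
  | word n η =>
    induction w using AlgFock.induction_on with
    | smul c v hv => simp only [map_smul, inner_smul_right, hv]
    | add v v' hv hv' => simp only [map_add, inner_add_right, hv, hv']
    | word m ξ =>
      rw [secondQuant_word, secondQuant_word, inner_toFock, inner_toFock]
      by_cases h : n = m
      · subst h
        rw [qInner_word_word, qInner_word_word]
        refine Finset.sum_congr rfl fun σ _ => ?_
        congr 1
        exact Finset.prod_congr rfl fun j _ => hP _ _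
      · rw [qInner_word_word_of_ne _ h, qInner_word_word_of_ne _ h]

/-- A symmetric idempotent is a contraction: `‖Γv‖² = ⟨v, Γv⟩ ≤ ‖v‖ ‖Γv‖`. -/
theorem norm_secondQuant_le {P : H →L[ℂ] H} (hP : P.toLinearMap.IsSymmetric)
    (hP2 : ∀ x, P (P x) = P x) (v : AlgFock H) :
    ‖toFock q (secondQuant P v)‖ ≤ 1 * ‖toFock q v‖ := by
  rw [one_mul]
  rcases (norm_nonneg (toFock q (secondQuant P v))).eq_or_lt with h | h
  · exact h ▸ norm_nonneg _
  refine le_of_mul_le_mul_right ?_ h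
  rw [← sq, ← inner_self_eq_norm_sq (𝕜 := ℂ), inner_secondQuant q hP,
    secondQuant_secondQuant hP2]
  exact (RCLike.re_le_norm _).trans (norm_inner_le_norm _ _)

/-- The second quantization of a projection, as a bounded operator on the `q`-Fock space. -/
def fockProj (P : H →L[ℂ] H) : FockSpace q H →L[ℂ] FockSpace q H :=
  (toFock q ∘ₗ secondQuant P).extendOfNorm (toFock q)

theorem fockProj_toFock {P : H →L[ℂ] H} (hP : P.toLinearMap.IsSymmetric)
    (hP2 : ∀ x, P (P x) = P x) (v : AlgFock H) :
    fockProj q P (toFock q v) = toFock q (secondQuant P v) :=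
  LinearMap.extendOfNorm_eq (f := toFock q ∘ₗ secondQuant P) (e := toFock q)
    (denseRange_toFock q) ⟨1, norm_secondQuant_le q hP hP2⟩ v

theorem fockProj_vacuum {P : H →L[ℂ] H} (hP : P.toLinearMap.IsSymmetric)
    (hP2 : ∀ x, P (P x) = P x) : fockProj q P (vacuum q) = vacuum q := by
  rw [vacuum, fockProj_toFock q hP hP2, secondQuant_word]
  congr 2
  exact Subsingleton.elim _ _

theorem star_fockProj {P : H →L[ℂ] H} (hP : P.toLinearMap.IsSymmetric)
    (hP2 : ∀ x, P (P x) = P x) : star (fockProj q P) = fockProj q P := by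
  refine isSymmetric_of_inner_toFock q fun v w => ?_
  rw [fockProj_toFock q hP hP2, fockProj_toFock q hP hP2, inner_secondQuant q hP]

theorem fockProj_mul_fieldOperator {P T : H →L[ℂ] H} {ζ : H} (hP : P.toLinearMap.IsSymmetric)
    (hP2 : ∀ x, P (P x) = P x) (hT : T.toLinearMap.IsSymmetric) (hζ : P ζ = ζ)
    (hPT : ∀ x, P (T x) = T (P x)) :
    fockProj q P * fieldOperator q ζ T = fieldOperator q ζ T * fockProj q P := by
  refine fockOperator_ext q fun n η => ?_
  simp only [mul_apply_eq_comp, fieldOperator_toFock q ζ hT, fockProj_toFock q hP hP2,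
    secondQuant_algField q hP hζ hPT]

theorem fockProj_field_field_fockProj {P T S : H →L[ℂ] H} {ζ ξ : H}
    (hP : P.toLinearMap.IsSymmetric) (hP2 : ∀ x, P (P x) = P x)
    (hT : T.toLinearMap.IsSymmetric) (hS : S.toLinearMap.IsSymmetric)
    (hPT : ∀ x, P (T x) = T (P x)) (hξ : P ξ = 0) (hSP : ∀ x, S (P x) = 0) :
    fockProj q P * fieldOperator q ζ T * fieldOperator q ξ S * fockProj q P =
      ⟪ζ, ξ⟫_ℂ • fockProj q P := by
  refine fockOperator_ext q fun n η => ?_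
  simp only [mul_apply_eq_comp, smul_apply,
    fieldOperator_toFock q _ hT, fieldOperator_toFock q _ hS, fockProj_toFock q hP hP2,
    secondQuant_algField_algField q hP hP2 hPT hξ hSP, map_smul]

/-! ### Right creation by a vector orthogonal to the range of a projection -/

/-- Appending a letter raises the degree by one, so a one-particle vector on the left pairs only
with the degree-zero part of the argument. -/
theorem inner_creation_vacuum_rightCreation {P : H →L[ℂ] H} (χ ξ : H) (v : AlgFock H) :
    ⟪toFock q (creation χ (word Fin.elim0)), toFock q (rightCreation ξ (secondQuant P v))⟫_ℂ =
      ⟪χ, ξ⟫_ℂ * ⟪toFock q (word Fin.elim0), toFock q (secondQuant P v)⟫_ℂ := by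
  induction v using AlgFock.induction_on with
  | smul c v hv =>
    simp only [map_smul, inner_smul_right, hv]
    ring
  | add v v' hv hv' => simp only [map_add, inner_add_right, hv, hv', mul_add]
  | word n η =>
    rw [secondQuant_word, rightCreation_word, creation_word, inner_toFock, inner_toFock]
    cases n with
    | zero =>
      rw [qInner_word_word, qInner_word_word]
      simp [inversions_fin_one, inversions_fin_zero, Fin.snoc]
    | succ n =>
      rw [qInner_word_word_of_ne _ (by omega), qInner_word_word_of_ne _ (by omega), mul_zero]

/-- The letters of the left word are peeled off one at a time and moved across as annihilations.
These pass the appended `ξ` because `⟨P η, ξ⟩ = ⟨η, P ξ⟩ = 0`, and they keep the other argument in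
the range of the projection, so the induction runs for all `w`. -/
theorem inner_rightCreation {P : H →L[ℂ] H} (hP : P.toLinearMap.IsSymmetric)
    {ξ : H} (hξ : P ξ = 0) (v w : AlgFock H) :
    ⟪toFock q (rightCreation ξ (secondQuant P v)), toFock q (rightCreation ξ (secondQuant P w))⟫_ℂ =
      ⟪ξ, ξ⟫_ℂ * ⟪toFock q (secondQuant P v), toFock q (secondQuant P w)⟫_ℂ := by
  induction v using AlgFock.induction_on with
  | smul c v hv =>
    simp only [map_smul, inner_smul_left, hv]
    ring
  | add v v' hv hv' => simp only [map_add, inner_add_left, hv, hv', mul_add]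
  | word n η =>
    induction n generalizing w with
    | zero =>
      have h1 : secondQuant P (word η) = word Fin.elim0 := by
        rw [secondQuant_word]
        congr 1
        exact Subsingleton.elim _ _
      have h2 : rightCreation ξ (word (Fin.elim0 : Fin 0 → H)) =
          creation ξ (word Fin.elim0) := by
        rw [rightCreation_word, creation_word]
        congr 1
        ext i
        fin_cases i
        rfl
      rw [h1, h2, inner_creation_vacuum_rightCreation]
    | succ n ih =>
      have hη : word η = creation (η 0) (word (Fin.tail η)) := by
        rw [creation_word, Fin.cons_self_tail]
      have ho : ⟪P (η 0), ξ⟫_ℂ = 0 := by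
        have h : ⟪P (η 0), ξ⟫_ℂ = ⟪η 0, P ξ⟫_ℂ := hP _ _
        rw [h, hξ, inner_zero_right]
      rw [hη, secondQuant_creation, rightCreation_creation, inner_creation, inner_creation,
        annihilation_rightCreation _ ho, annihilation_secondQuant _ hP, ih]

theorem norm_rightCreation_le {P : H →L[ℂ] H} (hP : P.toLinearMap.IsSymmetric)
    (hP2 : ∀ x, P (P x) = P x) {ξ : H} (hξ : P ξ = 0) (v : AlgFock H) :
    ‖toFock q (rightCreation ξ (secondQuant P v))‖ ≤ ‖ξ‖ * ‖toFock q v‖ := by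
  have h : ‖toFock q (rightCreation ξ (secondQuant P v))‖ =
      ‖ξ‖ * ‖toFock q (secondQuant P v)‖ := by
    rw [← sq_eq_sq₀ (norm_nonneg _) (by positivity), mul_pow]
    have h := inner_rightCreation q hP hξ v v
    simp only [inner_self_eq_norm_sq_to_K] at h
    exact_mod_cast h
  rw [h]
  have := norm_secondQuant_le q hP hP2 v
  rw [one_mul] at this
  gcongr

/-- The operator `η ↦ P η ⊗ ξ` on the `q`-Fock space. -/
def rightOperator (P : H →L[ℂ] H) (ξ : H) : FockSpace q H →L[ℂ] FockSpace q H :=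
  (toFock q ∘ₗ rightCreation ξ ∘ₗ secondQuant P).extendOfNorm (toFock q)

theorem rightOperator_toFock {P : H →L[ℂ] H} (hP : P.toLinearMap.IsSymmetric)
    (hP2 : ∀ x, P (P x) = P x) {ξ : H} (hξ : P ξ = 0) (v : AlgFock H) :
    rightOperator q P ξ (toFock q v) = toFock q (rightCreation ξ (secondQuant P v)) :=
  LinearMap.extendOfNorm_eq (f := toFock q ∘ₗ rightCreation ξ ∘ₗ secondQuant P) (e := toFock q)
    (denseRange_toFock q) ⟨‖ξ‖, norm_rightCreation_le q hP hP2 hξ⟩ v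

theorem rightOperator_vacuum {P : H →L[ℂ] H} (hP : P.toLinearMap.IsSymmetric)
    (hP2 : ∀ x, P (P x) = P x) {ξ : H} (hξ : P ξ = 0) :
    rightOperator q P ξ (vacuum q) = toFock q (creation ξ (word Fin.elim0)) := by
  rw [vacuum, rightOperator_toFock q hP hP2 hξ, secondQuant_word, rightCreation_word,
    creation_word]
  congr 2
  ext i
  fin_cases i
  rfl

/-- The field acts from the left on letters of the past, the operator appends on the right a letter
which that field neither annihilates nor moves. -/
theorem rightOperator_mul_fieldOperator {P T : H →L[ℂ] H} {ζ ξ : H}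
    (hP : P.toLinearMap.IsSymmetric) (hP2 : ∀ x, P (P x) = P x)
    (hT : T.toLinearMap.IsSymmetric) (hζ : P ζ = ζ)
    (hPT : ∀ x, P (T x) = T (P x)) (hξ : P ξ = 0) (hTξ : T ξ = 0) :
    rightOperator q P ξ * fieldOperator q ζ T = fieldOperator q ζ T * rightOperator q P ξ := by
  have ho : ⟪ζ, ξ⟫_ℂ = 0 := by
    have h : ⟪P ζ, ξ⟫_ℂ = ⟪ζ, P ξ⟫_ℂ := hP _ _
    rw [← hζ, h, hξ, inner_zero_right]
  refine fockOperator_ext q fun n η => ?_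
  simp only [mul_apply_eq_comp, fieldOperator_toFock q ζ hT,
    rightOperator_toFock q hP hP2 hξ, secondQuant_algField q hP hζ hPT,
    rightCreation_algField q ho hTξ]

theorem inner_rightOperator {P : H →L[ℂ] H} (hP : P.toLinearMap.IsSymmetric)
    (hP2 : ∀ x, P (P x) = P x) {ξ : H} (hξ : P ξ = 0) (χ : H) (w : FockSpace q H) :
    ⟪toFock q (creation χ (word Fin.elim0)), rightOperator q P ξ w⟫_ℂ =
      ⟪χ, ξ⟫_ℂ * ⟪vacuum q, w⟫_ℂ := by
  induction w using (denseRange_toFock q (H := H)).induction_on with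
  | hp => exact isClosed_eq (by fun_prop) (by fun_prop)
  | ih v =>
    rw [rightOperator_toFock q hP hP2 hξ, inner_creation_vacuum_rightCreation,
      ← inner_secondQuant q hP, ← fockProj_toFock q hP hP2, ← vacuum, fockProj_vacuum q hP hP2]

theorem fieldOperator_vacuum {T : H →L[ℂ] H} (ζ : H) (hT : T.toLinearMap.IsSymmetric) :
    fieldOperator q ζ T (vacuum q) = toFock q (creation ζ (word Fin.elim0)) := by
  rw [vacuum, fieldOperator_toFock q ζ hT, algField_apply, annihilation_vacuum, gauge_vacuum,
    zero_add, add_zero]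

/-- Needed to write an increment over `[a, b)` as a difference of two generators starting at time
`0`. -/
theorem fieldOperator_sub (ζ ζ' : H) {T T' : H →L[ℂ] H} (hT : T.toLinearMap.IsSymmetric)
    (hT' : T'.toLinearMap.IsSymmetric) :
    fieldOperator q (ζ - ζ') (T - T') = fieldOperator q ζ T - fieldOperator q ζ' T' := by
  have hs : (T - T').toLinearMap.IsSymmetric := hT.sub hT'
  refine fockOperator_ext q fun n η => ?_
  rw [sub_apply, fieldOperator_toFock q _ hs, fieldOperator_toFock q _ hT,
    fieldOperator_toFock q _ hT', ← map_sub]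
  congr 1
  simp only [algField_apply]
  cases n with
  | zero =>
    simp only [annihilation_vacuum, gauge_vacuum, creation_word, word_cons_sub]
    abel
  | succ n =>
    have h (a b : ℂ) (w : AlgFock H) : (a - b) • w = a • w - b • w := sub_smul a b w
    simp only [annihilation_word, gauge_word, creation_word, word_cons_sub, inner_sub_left,
      sub_apply, mul_sub, h, smul_sub, Finset.sum_sub_distrib]
    abel

end Completed

end QFock

/-! ### Commutation with a generated von Neumann algebra -/

namespace QFock

universe u

/-- An operator commuting with a set of self-adjoint operators commutes with the von Neumann
algebra generated by that set. -/
theorem mul_comm_of_mem_generatedVN {K : Type u} [NormedAddCommGroup K] [InnerProductSpace ℂ K]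
    [CompleteSpace K] {S : Set (K →L[ℂ] K)} (hS : ∀ A ∈ S, star A = A) {U B : K →L[ℂ] K}
    (hU : U ∈ generatedVN S) (hB : ∀ A ∈ S, B * A = A * B) : B * U = U * B := by
  change U ∈ StarSubalgebra.centralizer ℂ (StarSubalgebra.centralizer ℂ S : Set (K →L[ℂ] K)) at hU
  rw [StarSubalgebra.mem_centralizer_iff] at hU
  refine (hU B ?_).1
  rw [SetLike.mem_coe, StarSubalgebra.mem_centralizer_iff]
  intro A hA
  -- Membership in the centralizer also asks for commutation with `star A`, which self-adjointness
  -- makes the same condition.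
  rw [hS A hA]
  exact ⟨(hB A hA).symm, (hB A hA).symm⟩

theorem conj_phiInner {q : Ioo (-1 : ℝ) 1} {H : Type u} [NormedAddCommGroup H]
    [InnerProductSpace ℂ H] (A B : FockSpace q H →L[ℂ] FockSpace q H) :
    conj (phiInner q A B) = phiInner q B A := by
  rw [phiInner_eq, phiInner_eq, inner_conj_symm]

end QFock

/-! ### Step functions, step vectors and multiplication operators -/

namespace QLevy

open QFock

theorem conj_stepFun (k : ℕ) (a b : ℝ) (p : ℝ × ℝ) : conj (stepFun k a b p) = stepFun k a b p := by
  by_cases h : p ∈ Ico a b ×ˢ (univ : Set ℝ) <;> simp [stepFun, h]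

theorem stepFun_mul (j k : ℕ) (a b c d : ℝ) (p : ℝ × ℝ) :
    stepFun j a b p * stepFun k c d p = stepFun (j + k) (max a c) (min b d) p := by
  have h : (Ico a b ×ˢ (univ : Set ℝ)) ∩ (Ico c d ×ˢ univ) = Ico (max a c) (min b d) ×ˢ univ := by
    rw [prod_inter_prod, Ico_inter_Ico, inter_univ]
  rw [stepFun, stepFun, stepFun, ← h]
  simp only [pow_add]
  exact (inter_indicator_mul (fun p : ℝ × ℝ => (p.2 : ℂ) ^ j)
    (fun p : ℝ × ℝ => (p.2 : ℂ) ^ k) p).symm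

theorem stepFun_sub (k : ℕ) {a b : ℝ} (ha : 0 ≤ a) (hab : a ≤ b) (p : ℝ × ℝ) :
    stepFun k 0 b p - stepFun k 0 a p = stepFun k a b p := by
  simp only [stepFun, indicator, mem_prod, mem_Ico, mem_univ, and_true]
  split_ifs <;> first | (exfalso; grind) | simp

section Levy

variable (q : Ioo (-1 : ℝ) 1) (ν : Measure ℝ) [IsFiniteMeasure ν] [IsCompactlySupported ν]

theorem coeFn_stepVector (k : ℕ) (a b : ℝ) :
    stepVector ν k a b =ᵐ[timeMeasure.prod ν] stepFun k a b :=
  (memLp_stepFun ν k a b 2).coeFn_toLp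

theorem coeFn_stepMul (k : ℕ) (a b : ℝ) (f : OneParticle ν) :
    stepMul ν k a b f =ᵐ[timeMeasure.prod ν] fun p => stepFun k a b p * f p := by
  filter_upwards [(ContinuousLinearMap.mul ℂ ℂ).coeFn_holder (r := 2)
    ((memLp_stepFun ν k a b ⊤).toLp _) f, (memLp_stepFun ν k a b ⊤).coeFn_toLp] with p hp hp2
  rw [hp2] at hp
  exact hp

theorem stepMul_isSymmetric (k : ℕ) (a b : ℝ) : (stepMul ν k a b).toLinearMap.IsSymmetric := by
  intro f g
  change ⟪stepMul ν k a b f, g⟫_ℂ = ⟪f, stepMul ν k a b g⟫_ℂ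
  rw [L2.inner_def, L2.inner_def]
  refine integral_congr_ae ?_
  filter_upwards [coeFn_stepMul ν k a b f, coeFn_stepMul ν k a b g] with p hf hg
  simp only [hf, hg, RCLike.inner_apply, map_mul, conj_stepFun]
  ring

/-- Intersections are recorded through `max` and `min` of the endpoints, so the later vanishing
statements become inequalities between endpoints. -/
theorem stepMul_stepMul (j k : ℕ) (a b c d : ℝ) (f : OneParticle ν) :
    stepMul ν j a b (stepMul ν k c d f) = stepMul ν (j + k) (max a c) (min b d) f := by
  refine Lp.ext ?_
  filter_upwards [coeFn_stepMul ν j a b (stepMul ν k c d f), coeFn_stepMul ν k c d f,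
    coeFn_stepMul ν (j + k) (max a c) (min b d) f] with p h1 h2 h3
  rw [h1, h2, h3, ← mul_assoc, stepFun_mul]

theorem stepMul_stepVector (j k : ℕ) (a b c d : ℝ) :
    stepMul ν j a b (stepVector ν k c d) = stepVector ν (j + k) (max a c) (min b d) := by
  refine Lp.ext ?_
  filter_upwards [coeFn_stepMul ν j a b (stepVector ν k c d), coeFn_stepVector ν k c d,
    coeFn_stepVector ν (j + k) (max a c) (min b d)] with p h1 h2 h3
  rw [h1, h2, h3, stepFun_mul]

theorem stepVector_eq_zero (k : ℕ) {a b : ℝ} (h : b ≤ a) : stepVector ν k a b = 0 := by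
  refine Lp.ext ?_
  filter_upwards [coeFn_stepVector ν k a b, Lp.coeFn_zero ℂ 2 (timeMeasure.prod ν)] with p h1 h2
  rw [h1, h2, stepFun, Ico_eq_empty (not_lt.2 h)]
  simp

theorem stepMul_eq_zero (k : ℕ) {a b : ℝ} (h : b ≤ a) (f : OneParticle ν) :
    stepMul ν k a b f = 0 := by
  refine Lp.ext ?_
  filter_upwards [coeFn_stepMul ν k a b f, Lp.coeFn_zero ℂ 2 (timeMeasure.prod ν)] with p h1 h2
  rw [h1, h2, stepFun, Ico_eq_empty (not_lt.2 h)]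
  simp

theorem stepVector_sub (k : ℕ) {a b : ℝ} (ha : 0 ≤ a) (hab : a ≤ b) :
    stepVector ν k 0 b - stepVector ν k 0 a = stepVector ν k a b := by
  refine Lp.ext ?_
  filter_upwards [coeFn_stepVector ν k 0 b, coeFn_stepVector ν k 0 a, coeFn_stepVector ν k a b,
    Lp.coeFn_sub (stepVector ν k 0 b) (stepVector ν k 0 a)] with p h1 h2 h3 h4
  rw [h4, Pi.sub_apply, h1, h2, h3, stepFun_sub k ha hab]

theorem stepMul_sub (k : ℕ) {a b : ℝ} (ha : 0 ≤ a) (hab : a ≤ b) :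
    stepMul ν k 0 b - stepMul ν k 0 a = stepMul ν k a b := by
  refine ContinuousLinearMap.ext fun f => Lp.ext ?_
  rw [sub_apply]
  filter_upwards [coeFn_stepMul ν k 0 b f, coeFn_stepMul ν k 0 a f, coeFn_stepMul ν k a b f,
    Lp.coeFn_sub (stepMul ν k 0 b f) (stepMul ν k 0 a f)] with p h1 h2 h3 h4
  rw [h4, Pi.sub_apply, h1, h2, h3, ← sub_mul, stepFun_sub k ha hab]

/-- The product of the two indicators integrates to `|[a,b) ∩ [c,d)| * ν(ℝ)`, and `r ν 2` is `∫ x ^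
0 ∂ν`. With `0 ≤ a` the intersection lies in the half-line, so restricting Lebesgue measure to it
loses nothing. -/
theorem inner_stepVector_zero {a c : ℝ} (b d : ℝ) (ha : 0 ≤ a) :
    ⟪stepVector ν 0 a b, stepVector ν 0 c d⟫_ℂ =
      (r ν 2 : ℂ) * (volume.real (Ico a b ∩ Ico c d) : ℂ) := by
  rw [L2.inner_def]
  have h1 : ∀ᵐ p ∂timeMeasure.prod ν, ⟪stepVector ν 0 a b p, stepVector ν 0 c d p⟫_ℂ =
      ((Ico a b ∩ Ico c d) ×ˢ (univ : Set ℝ)).indicator (fun _ => (1 : ℂ)) p := by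
    filter_upwards [coeFn_stepVector ν 0 a b, coeFn_stepVector ν 0 c d] with p h1 h2
    rw [h1, h2, RCLike.inner_apply, conj_stepFun, mul_comm, stepFun_mul, Ico_inter_Ico]
    simp [stepFun]
  rw [integral_congr_ae h1, integral_indicator_const _
    ((measurableSet_Ico.inter measurableSet_Ico).prod .univ), measureReal_prod_prod,
    measureReal_restrict_apply (measurableSet_Ico.inter measurableSet_Ico), inter_eq_left.2]
  · simp [r, mul_comm]
  · exact fun t ht => ha.trans ht.1.1

/-! ### The projection onto the past -/

/-- Multiplication by `χ_{[0, c)} ⊗ 1`. -/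
abbrev pastProj (c : ℝ) : OneParticle ν →L[ℂ] OneParticle ν := stepMul ν 0 0 c

theorem pastProj_isSymmetric (c : ℝ) : (pastProj ν c).toLinearMap.IsSymmetric :=
  stepMul_isSymmetric ν 0 0 c

theorem pastProj_pastProj (c : ℝ) (f : OneParticle ν) :
    pastProj ν c (pastProj ν c f) = pastProj ν c f := by
  rw [stepMul_stepMul, max_self, min_self]

theorem pastProj_stepMul (c : ℝ) (k : ℕ) (a b : ℝ) (f : OneParticle ν) :
    pastProj ν c (stepMul ν k a b f) = stepMul ν k a b (pastProj ν c f) := by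
  rw [stepMul_stepMul, stepMul_stepMul, max_comm, min_comm, add_comm]

theorem pastProj_stepVector_of_le {c : ℝ} (k : ℕ) {s : ℝ} (h : s ≤ c) :
    pastProj ν c (stepVector ν k 0 s) = stepVector ν k 0 s := by
  rw [stepMul_stepVector, zero_add, max_self, min_eq_right h]

theorem pastProj_stepVector_eq_zero {c : ℝ} (k : ℕ) {a : ℝ} (b : ℝ) (h : c ≤ a) :
    pastProj ν c (stepVector ν k a b) = 0 := by
  rw [stepMul_stepVector]
  exact stepVector_eq_zero ν _ ((min_le_left _ _).trans (h.trans (le_max_right _ _)))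

theorem stepMul_pastProj_eq_zero {c : ℝ} (k : ℕ) {a : ℝ} (b : ℝ) (h : c ≤ a)
    (f : OneParticle ν) : stepMul ν k a b (pastProj ν c f) = 0 := by
  rw [stepMul_stepMul]
  exact stepMul_eq_zero ν _ ((min_le_right _ _).trans (h.trans (le_max_left _ _))) f

theorem stepMul_stepVector_eq_zero (j k : ℕ) (a : ℝ) {s c : ℝ} (d : ℝ) (h : s ≤ c) :
    stepMul ν j a s (stepVector ν k c d) = 0 := by
  rw [stepMul_stepVector]
  exact stepVector_eq_zero ν _ ((min_le_left _ _).trans (h.trans (le_max_right _ _)))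

theorem star_Y (k : ℕ) (a b : ℝ) : star (Y q ν k a b) = Y q ν k a b :=
  star_fieldOperator q _ (stepMul_isSymmetric ν _ _ _)

/-! ### The filtration -/

variable {q ν}

theorem mul_comm_of_mem_filtration {c : ℝ}
    {U B : FockSpace q (OneParticle ν) →L[ℂ] FockSpace q (OneParticle ν)}
    (hU : U ∈ filtration q ν c)
    (hB : ∀ (k : ℕ) (s : ℝ), s < c → B * Y q ν k 0 s = Y q ν k 0 s * B) : B * U = U * B := by
  refine mul_comm_of_mem_generatedVN ?_ hU ?_
  · rintro _ ⟨k, s, -, -, rfl⟩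
    exact star_Y q ν k 0 s
  · rintro _ ⟨k, s, -, hs, rfl⟩
    exact hB k s hs

theorem filtration_mono {a c : ℝ} (h : a ≤ c) : filtration q ν a ≤ filtration q ν c := by
  refine generatedVN_le _ _ ?_
  rintro _ ⟨k, s, h0, hs, rfl⟩
  exact subset_generatedVN _ ⟨k, s, h0, hs.trans_le h, rfl⟩

theorem filtration_le_vonNeumann (c : ℝ) : filtration q ν c ≤ vonNeumann q ν := by
  refine generatedVN_le _ _ ?_
  rintro _ ⟨k, s, h0, -, rfl⟩
  exact subset_generatedVN _ ⟨k, s, h0, rfl⟩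

theorem X_mem_vonNeumann {a b : ℝ} (ha : 0 ≤ a) (hab : a ≤ b) : X q ν a b ∈ vonNeumann q ν := by
  have h : X q ν a b = Y q ν 0 0 b - Y q ν 0 0 a := by
    rw [X, Y, Y, Y, ← fieldOperator_sub q _ _ (stepMul_isSymmetric ν _ _ _)
      (stepMul_isSymmetric ν _ _ _), stepVector_sub ν 0 ha hab, stepMul_sub ν _ ha hab]
  rw [h]
  exact sub_mem (subset_generatedVN _ ⟨0, b, ha.trans hab, rfl⟩)
    (subset_generatedVN _ ⟨0, a, ha, rfl⟩)

theorem fockProj_mul_of_mem_filtration {c : ℝ}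
    {U : FockSpace q (OneParticle ν) →L[ℂ] FockSpace q (OneParticle ν)}
    (hU : U ∈ filtration q ν c) :
    fockProj q (pastProj ν c) * U = U * fockProj q (pastProj ν c) :=
  mul_comm_of_mem_filtration hU fun k _ hs =>
    fockProj_mul_fieldOperator q (pastProj_isSymmetric ν c) (pastProj_pastProj ν c)
      (stepMul_isSymmetric ν _ _ _) (pastProj_stepVector_of_le ν k hs.le)
      (pastProj_stepMul ν c _ _ _)

/-- The vector `UΩ` lies over the past: the projection commutes with `U` and fixes `Ω`. -/
theorem fockProj_apply_vacuum_of_mem_filtration {c : ℝ}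
    {U : FockSpace q (OneParticle ν) →L[ℂ] FockSpace q (OneParticle ν)}
    (hU : U ∈ filtration q ν c) :
    fockProj q (pastProj ν c) (U (vacuum q)) = U (vacuum q) := by
  rw [← mul_apply_eq_comp, fockProj_mul_of_mem_filtration hU, mul_apply_eq_comp,
    fockProj_vacuum q (pastProj_isSymmetric ν c) (pastProj_pastProj ν c)]

/-- The appended letter is supported on `[c, d)`, disjoint from the support `[0, s)` of every
generator before time `c`. -/
theorem rightOperator_mul_of_mem_filtration {c : ℝ} (d : ℝ)
    {U : FockSpace q (OneParticle ν) →L[ℂ] FockSpace q (OneParticle ν)}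
    (hU : U ∈ filtration q ν c) :
    rightOperator q (pastProj ν c) (stepVector ν 0 c d) * U =
      U * rightOperator q (pastProj ν c) (stepVector ν 0 c d) :=
  mul_comm_of_mem_filtration hU fun k _ hs =>
    rightOperator_mul_fieldOperator q (pastProj_isSymmetric ν c) (pastProj_pastProj ν c)
      (stepMul_isSymmetric ν _ _ _) (pastProj_stepVector_of_le ν k hs.le)
      (pastProj_stepMul ν c _ _ _) (pastProj_stepVector_eq_zero ν 0 d le_rfl)
      (stepMul_stepVector_eq_zero ν _ 0 0 d hs.le)

/-! ### The isometry property on elementary processes -/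

theorem inner_apply_of_star_eq {K : Type*} [NormedAddCommGroup K] [InnerProductSpace ℂ K]
    [CompleteSpace K] {A : K →L[ℂ] K} (hA : star A = A) (x y : K) : ⟪A x, y⟫_ℂ = ⟪x, A y⟫_ℂ := by
  conv_lhs => rw [← hA, ContinuousLinearMap.star_eq_adjoint,
    ContinuousLinearMap.adjoint_inner_left]

/-- Both coefficients belong to the algebra at the later time `c`, so a projection onto the past of
`c` may be inserted on each side of the product of increments, which it compresses to a scalar. -/
theorem phiInner_X_mul_of_le {a c : ℝ} (b d : ℝ) (hac : a ≤ c)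
    {U V : FockSpace q (OneParticle ν) →L[ℂ] FockSpace q (OneParticle ν)}
    (hU : U ∈ filtration q ν a) (hV : V ∈ filtration q ν c) :
    phiInner q (X q ν a b * U) (X q ν c d * V) =
      ⟪stepVector ν 0 a b, stepVector ν 0 c d⟫_ℂ * phiInner q U V := by
  have hU' := filtration_mono hac hU
  have key := congrArg (fun A => A (V (vacuum q))) (fockProj_field_field_fockProj q
    (ζ := stepVector ν 0 a b) (ξ := stepVector ν 0 c d) (P := pastProj ν c)
    (T := stepMul ν 1 a b) (S := stepMul ν 1 c d) (pastProj_isSymmetric ν c)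
    (pastProj_pastProj ν c) (stepMul_isSymmetric ν _ _ _) (stepMul_isSymmetric ν _ _ _)
    (pastProj_stepMul ν c _ _ _) (pastProj_stepVector_eq_zero ν 0 d le_rfl)
    (stepMul_pastProj_eq_zero ν 1 d le_rfl))
  simp only [mul_apply_eq_comp, smul_apply, fockProj_apply_vacuum_of_mem_filtration hV] at key
  -- The left increment is self-adjoint and moves to the right; then `UΩ` is replaced by its
  -- projection, which also moves across to produce the left-hand side of `key`.
  rw [phiInner_eq, phiInner_eq, mul_apply_eq_comp, mul_apply_eq_comp,
    inner_apply_of_star_eq (star_Y q ν 0 a b),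
    ← fockProj_apply_vacuum_of_mem_filtration hU',
    inner_apply_of_star_eq (star_fockProj q (pastProj_isSymmetric ν c) (pastProj_pastProj ν c)),
    fockProj_apply_vacuum_of_mem_filtration hU', ← inner_smul_right, ← key]
  rfl

/-- The later increment applied to `Ω` equals the right operator applied to `Ω`. That operator
commutes with `V` and with `star U`, so it comes out in front of `star U * V` and only the vacuum
expectation of this product is seen. -/
theorem phiInner_mul_X_of_le {a c : ℝ} (b d : ℝ) (hac : a ≤ c)
    {U V : FockSpace q (OneParticle ν) →L[ℂ] FockSpace q (OneParticle ν)}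
    (hU : U ∈ filtration q ν a) (hV : V ∈ filtration q ν c) :
    phiInner q (U * X q ν a b) (V * X q ν c d) =
      ⟪stepVector ν 0 a b, stepVector ν 0 c d⟫_ℂ * phiInner q U V := by
  have hU' : star U ∈ filtration q ν c := star_mem (filtration_mono hac hU)
  have hP := pastProj_isSymmetric ν c
  have hP2 := pastProj_pastProj ν c
  have hξ := pastProj_stepVector_eq_zero ν 0 d (le_refl c)
  have hs := stepMul_isSymmetric ν 1
  have hX : ∀ a b, X q ν a b (vacuum q) =
      toFock q (creation (stepVector ν 0 a b) (word Fin.elim0)) := fun a b =>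
    fieldOperator_vacuum q _ (hs a b)
  have hc : ∀ W ∈ filtration q ν c, ∀ x,
      W (rightOperator q (pastProj ν c) (stepVector ν 0 c d) x) =
        rightOperator q (pastProj ν c) (stepVector ν 0 c d) (W x) := fun W hW x => by
    rw [← mul_apply_eq_comp, ← rightOperator_mul_of_mem_filtration d hW, mul_apply_eq_comp]
  rw [phiInner_eq, phiInner_eq, mul_apply_eq_comp, mul_apply_eq_comp, hX c d,
    ← rightOperator_vacuum q hP hP2 hξ, hc V hV, ← ContinuousLinearMap.adjoint_inner_right,
    ← ContinuousLinearMap.star_eq_adjoint, hc _ hU', hX a b, inner_rightOperator q hP hP2 hξ,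
    ContinuousLinearMap.star_eq_adjoint, ContinuousLinearMap.adjoint_inner_right]

/-- A pairing of elementary processes that is conjugate-symmetric may be computed for ordered
starting times. -/
theorem phiInner_eq_of_le
    {F : AdaptedStep q ν → FockSpace q (OneParticle ν) →L[ℂ] FockSpace q (OneParticle ν)}
    (h : ∀ s v : AdaptedStep q ν, s.a ≤ v.a → phiInner q (F s) (F v) =
      ⟪stepVector ν 0 s.a s.b, stepVector ν 0 v.a v.b⟫_ℂ * phiInner q s.op v.op)
    (s v : AdaptedStep q ν) : phiInner q (F s) (F v) =
      (r ν 2 : ℂ) * ((volume.real (Ico s.a s.b ∩ Ico v.a v.b) : ℂ) * phiInner q s.op v.op) := by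
  rw [← mul_assoc, ← inner_stepVector_zero ν s.b v.b s.a_nonneg]
  rcases le_total s.a v.a with hsv | hsv
  · exact h s v hsv
  -- Both sides are Hermitian in the pair of steps, so conjugation exchanges the starting times.
  · rw [← conj_phiInner, h v s hsv, map_mul, conj_phiInner, inner_conj_symm]

/-! ### The isometry property on simple processes -/

theorem toB2_cons (s : AdaptedStep q ν) (U : List (AdaptedStep q ν)) :
    toB2 (s :: U) = toB2 [s] + toB2 U := by
  rw [toB2, toB2, toB2, ← Completion.coe_add]
  congr 1
  refine Subtype.ext (funext fun t => ?_)
  change process (s :: U) t = process [s] t + process U t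
  simp [process]

theorem toB2_nil : toB2 ([] : List (AdaptedStep q ν)) = 0 := by
  rw [toB2, ← Completion.coe_zero]
  rfl

theorem inner_toB2_singleton (s v : AdaptedStep q ν) :
    ⟪toB2 [s], toB2 [v]⟫_ℂ =
      (volume.real (Ico s.a s.b ∩ Ico v.a v.b) : ℂ) * phiInner q s.op v.op := by
  rw [inner_toB2]
  have h : (fun t => phiInner q (process [s] t) (process [v] t)) =
      (Ico s.a s.b ∩ Ico v.a v.b).indicator fun _ => phiInner q s.op v.op := by
    funext t
    simp only [process, List.map_cons, List.map_nil, List.sum_cons, List.sum_nil, add_zero,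
      phiInner_eq]
    by_cases h1 : t ∈ Ico s.a s.b <;> by_cases h2 : t ∈ Ico v.a v.b <;> simp [h1, h2]
  rw [h, integral_indicator_const _ (measurableSet_Ico.inter measurableSet_Ico),
    measureReal_restrict_apply (measurableSet_Ico.inter measurableSet_Ico), inter_eq_left.2]
  · simp
  · exact fun t ht => s.a_nonneg.trans ht.1.1

/-- A sum over elementary processes is isometric up to the factor `r₂` if it is so on pairs of
elementary processes. -/
theorem phiInner_sum_eq
    {F : AdaptedStep q ν → FockSpace q (OneParticle ν) →L[ℂ] FockSpace q (OneParticle ν)}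
    (h : ∀ s v : AdaptedStep q ν, phiInner q (F s) (F v) =
      (r ν 2 : ℂ) * ((volume.real (Ico s.a s.b ∩ Ico v.a v.b) : ℂ) * phiInner q s.op v.op))
    (U V : List (AdaptedStep q ν)) :
    phiInner q (U.map F).sum (V.map F).sum = (r ν 2 : ℂ) * ⟪toB2 U, toB2 V⟫_ℂ := by
  induction U with
  | nil => simp [phiInner_eq, toB2_nil]
  | cons s U ih =>
    rw [toB2_cons s U, inner_add_left, mul_add, ← ih, List.map_cons, List.sum_cons]
    simp only [phiInner_eq, add_apply, inner_add_left]
    congr 1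
    clear ih
    induction V with
    | nil => simp [toB2_nil]
    | cons v V ih =>
      rw [toB2_cons v V, inner_add_right, mul_add, ← ih, List.map_cons, List.sum_cons,
        inner_toB2_singleton, ← h, phiInner_eq, add_apply, inner_add_right]

theorem phiInner_rightIntegral (U V : List (AdaptedStep q ν)) :
    phiInner q (rightIntegral U) (rightIntegral V) = (r ν 2 : ℂ) * ⟪toB2 U, toB2 V⟫_ℂ :=
  phiInner_sum_eq (phiInner_eq_of_le fun s v h =>
    phiInner_X_mul_of_le s.b v.b h s.op_mem v.op_mem) U V

theorem phiInner_leftIntegral (U V : List (AdaptedStep q ν)) :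
    phiInner q (leftIntegral U) (leftIntegral V) = (r ν 2 : ℂ) * ⟪toB2 U, toB2 V⟫_ℂ :=
  phiInner_sum_eq (phiInner_eq_of_le fun s v h =>
    phiInner_mul_X_of_le s.b v.b h s.op_mem v.op_mem) U V

theorem rightIntegral_mem (U : List (AdaptedStep q ν)) : rightIntegral U ∈ vonNeumann q ν := by
  refine list_sum_mem fun A hA => ?_
  obtain ⟨s, -, rfl⟩ := List.mem_map.1 hA
  exact mul_mem (X_mem_vonNeumann s.a_nonneg s.a_le_b) (filtration_le_vonNeumann _ s.op_mem)

theorem leftIntegral_mem (U : List (AdaptedStep q ν)) : leftIntegral U ∈ vonNeumann q ν := by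
  refine list_sum_mem fun A hA => ?_
  obtain ⟨s, -, rfl⟩ := List.mem_map.1 hA
  exact mul_mem (filtration_le_vonNeumann _ s.op_mem) (X_mem_vonNeumann s.a_nonneg s.a_le_b)

end Levy

end QLevy

/-- If the Gram matrix of `y` is `c` times that of a family `x` with dense range, then `x i ↦ y i`
extends to a continuous linear map that is isometric up to the factor `c`. -/
theorem exists_extension_of_inner_eq {ι E F : Type*} [NormedAddCommGroup E]
    [InnerProductSpace ℂ E] [NormedAddCommGroup F] [InnerProductSpace ℂ F] [CompleteSpace F]
    {x : ι → E} {y : ι → F} {c : ℝ} (h : ∀ i j, ⟪y i, y j⟫_ℂ = (c : ℂ) * ⟪x i, x j⟫_ℂ)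
    (hx : DenseRange x) :
    ∃ J : E →L[ℂ] F, (∀ i, J (x i) = y i) ∧ ∀ u v, ⟪J u, J v⟫_ℂ = (c : ℂ) * ⟪u, v⟫_ℂ := by
  classical
  -- The index set carries no linear structure, so the map is first defined on formal combinations.
  -- The Gram identity bounds `f` by `e`, which gives well-definedness as well as continuity.
  set e : (ι →₀ ℂ) →ₗ[ℂ] E := Finsupp.linearCombination ℂ x
  set f : (ι →₀ ℂ) →ₗ[ℂ] F := Finsupp.linearCombination ℂ y
  have hfe : ∀ a b, ⟪f a, f b⟫_ℂ = (c : ℂ) * ⟪e a, e b⟫_ℂ := by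
    intro a b
    simp only [e, f, Finsupp.linearCombination_apply, Finsupp.sum, sum_inner, inner_sum,
      inner_smul_left, inner_smul_right, h, Finset.mul_sum]
    exact Finset.sum_congr rfl fun i _ => Finset.sum_congr rfl fun j _ => by ring
  have he : DenseRange e := by
    refine hx.mono ?_
    rintro _ ⟨i, rfl⟩
    exact ⟨Finsupp.single i 1, by simp [e]⟩
  have hnorm : ∃ C, ∀ a, ‖f a‖ ≤ C * ‖e a‖ := by
    -- The absolute value is taken because no sign of `c` is assumed.
    refine ⟨√|c|, fun a => ?_⟩
    refine (abs_le_of_sq_le_sq' ?_ (by positivity)).2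
    have h1 := congrArg RCLike.re (hfe a a)
    rw [mul_pow, Real.sq_sqrt (abs_nonneg c), ← inner_self_eq_norm_sq (𝕜 := ℂ), h1,
      RCLike.re_eq_complex_re, Complex.re_ofReal_mul, ← RCLike.re_eq_complex_re,
      inner_self_eq_norm_sq]
    exact mul_le_mul_of_nonneg_right (le_abs_self c) (sq_nonneg _)
  have hJ : ∀ a, f.extendOfNorm e (e a) = f a := LinearMap.extendOfNorm_eq he hnorm
  refine ⟨f.extendOfNorm e, fun i => ?_, fun u v => ?_⟩
  · simpa [e, f] using hJ (Finsupp.single i 1)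
  · induction u, v using he.induction_on₂ with
    | hp => exact isClosed_eq (by fun_prop) (by fun_prop)
    | h a b => rw [hJ, hJ, hfe]

/-! ### Extension of the integrals to the completed space of processes -/

namespace QLevy

open QFock

variable {q : Ioo (-1 : ℝ) 1} {ν : Measure ℝ} [IsFiniteMeasure ν] [IsCompactlySupported ν]

theorem denseRange_toB2 : DenseRange (toB2 : List (AdaptedStep q ν) → B2 q ν) := by
  refine (Completion.denseRange_coe (α := PreB2 q ν)).mono ?_
  rintro _ ⟨⟨_, U, rfl⟩, rfl⟩
  exact ⟨U, rfl⟩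

/-- The pairing identity already forces lists with the same class in `B2` to have integrals with the
same class in `L2`, so independence of the representation needs no separate check. Uniqueness is
density of simple processes. -/
theorem exists_unique_extends
    {I : List (AdaptedStep q ν) →
      (FockSpace q (OneParticle ν) →L[ℂ] FockSpace q (OneParticle ν))}
    (hmem : ∀ U, I U ∈ vonNeumann q ν)
    (hI : ∀ U V, phiInner q (I U) (I V) = (r ν 2 : ℂ) * ⟪toB2 U, toB2 V⟫_ℂ) :
    ∃ J : B2 q ν →L[ℂ] L2 (vonNeumann q ν), Extends I J ∧
      (∀ u v : B2 q ν, ⟪J u, J v⟫_ℂ = (r ν 2 : ℂ) * ⟪u, v⟫_ℂ) ∧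
      ∀ J' : B2 q ν →L[ℂ] L2 (vonNeumann q ν), Extends I J' → J' = J := by
  obtain ⟨J, hJ, hJ2⟩ := exists_extension_of_inner_eq (x := toB2)
    (y := fun U => toL2 (vonNeumann q ν) (I U) (hmem U)) (c := r ν 2)
    (fun U V => by rw [inner_toL2, hI]) denseRange_toB2
  refine ⟨J, fun U => ⟨hmem U, hJ U⟩, hJ2, fun J' hJ' => ?_⟩
  refine ContinuousLinearMap.ext fun u => ?_
  induction u using (denseRange_toB2 (q := q) (ν := ν)).induction_on with
  | hp => exact isClosed_eq J'.continuous J.continuous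
  | ih U => rw [hJ U, (hJ' U).2]

end QLevy

end

theorem mainTheorem10 (q : Set.Ioo (-1 : ℝ) 1) (ν : MeasureTheory.Measure ℝ)
    [MeasureTheory.IsFiniteMeasure ν] [QLevy.IsCompactlySupported ν] :
    (∀ U V : List (QLevy.AdaptedStep q ν),
      QFock.phiInner q (QLevy.rightIntegral U) (QLevy.rightIntegral V) =
        (QLevy.r ν 2 : ℂ) *
          ∫ t in Set.Ici (0 : ℝ), QFock.phiInner q (QLevy.process U t) (QLevy.process V t)) ∧
    (∀ U V : List (QLevy.AdaptedStep q ν),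
      QFock.phiInner q (QLevy.leftIntegral U) (QLevy.leftIntegral V) =
        (QLevy.r ν 2 : ℂ) *
          ∫ t in Set.Ici (0 : ℝ), QFock.phiInner q (QLevy.process U t) (QLevy.process V t)) ∧
    (∃ J : QLevy.B2 q ν →L[ℂ] QFock.L2 (QLevy.vonNeumann q ν),
      QLevy.Extends QLevy.rightIntegral J ∧
      (∀ u v : QLevy.B2 q ν, ⟪J u, J v⟫_ℂ = (QLevy.r ν 2 : ℂ) * ⟪u, v⟫_ℂ) ∧
      ∀ J' : QLevy.B2 q ν →L[ℂ] QFock.L2 (QLevy.vonNeumann q ν),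
        QLevy.Extends QLevy.rightIntegral J' → J' = J) ∧
    (∃ J : QLevy.B2 q ν →L[ℂ] QFock.L2 (QLevy.vonNeumann q ν),
      QLevy.Extends QLevy.leftIntegral J ∧
      (∀ u v : QLevy.B2 q ν, ⟪J u, J v⟫_ℂ = (QLevy.r ν 2 : ℂ) * ⟪u, v⟫_ℂ) ∧
      ∀ J' : QLevy.B2 q ν →L[ℂ] QFock.L2 (QLevy.vonNeumann q ν),
        QLevy.Extends QLevy.leftIntegral J' → J' = J) := by
  refine ⟨fun U V => ?_, fun U V => ?_, ?_, ?_⟩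
  · rw [QLevy.phiInner_rightIntegral, QLevy.inner_toB2]
  · rw [QLevy.phiInner_leftIntegral, QLevy.inner_toB2]
  · exact QLevy.exists_unique_extends QLevy.rightIntegral_mem QLevy.phiInner_rightIntegral
  · exact QLevy.exists_unique_extends QLevy.leftIntegral_mem QLevy.phiInner_leftIntegral
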